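/- For $l=0,1,2,\dots$, an irreducible representation of $SO(3)$ of order $l$ is a continuous homomorphism $D^l$ from $SO(3)$ to the invertible real $(2l+1)\times(2l+1)$ matrices for which $\mathbb{R}^{2l+1}$ is irreducible. A spherical harmonic of order $l$ for $D^l$ is a function $Y^l=(Y^l_{-l},\dots,Y^l_l)$ from the unit sphere $S^2\subset\mathbb{R}^3$ to $\mathbb{R}^{2l+1}$ such that $Y^l(Rx)=D^l(R)\,Y^l(x)$ for all $R\in SO(3)$, $x\in S^2$, and $\|Y^l(x)\|=1$ for all $x\in S^2$ (Euclidean norm). Lemma. (a) For every $l\ge 0$ there is an irreducible representation of order $l$ by orthogonal matrices, and for every such orthogonal representation there is a spherical harmonic of order $l$. (b) Let $(D^l)_{l\ge0}$ be any family of irreducible representations of orders $l$, and $(Y^l)_{l\ge 0}$ any family of spherical harmonics for them. Then there are real polynomials $P^l_m$ on $\mathbb{R}^3$ ($l\ge0$, $-l\le m\le l$), homogeneous of degree $l$, with $P^l_m=Y^l_m$ on $S^2$ and $P^l_m(Rx)=\sum_{n=-l}^{l} D^l(R)_{mn}P^l_n(x)$ for all $R\in SO(3)$, $x\in\mathbb{R}^3$.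 Moreover, for every $l\ge0$, the space of homogeneous polynomials of degree $l$ on $\mathbb{R}^3$ is the direct sum, over $0\le k\le\lfloor l/2\rfloor$, of the spaces $\|x\|^{2k}\cdot\mathrm{span}\{P^{l-2k}_m : -(l-2k)\le m\le l-2k\}$, and the $k$-th of these spaces has dimension $2(l-2k)+1$. (c) For every $l\ge0$, the space of real homogeneous polynomials of degree $l$ in three variables has dimension $$\frac{(l+2)(l+1)}{2}=\sum_{k=0}^{\lfloor l/2\rfloor}\bigl(2(l-2k)+1\bigr)=(2l+1)+(2l-3)+(2l-7)+\cdots .$$ -/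

import Mathlib

open scoped Matrix

/-- The group of rotations of three-dimensional space. -/
abbrev SO3 : Type := Matrix.specialOrthogonalGroup (Fin 3) ℝ

/-- Euclidean three-space. -/
abbrev E3 : Type := EuclideanSpace ℝ (Fin 3)

/-- The unit sphere of Euclidean three-space. -/
abbrev S2 : Type := Metric.sphere (0 : E3) 1

/-- The rotation `R` applied to the vector `x`. -/
noncomputable def rotate (R : SO3) (x : E3) : E3 :=
  WithLp.toLp 2 ((R : Matrix (Fin 3) (Fin 3) ℝ) *ᵥ x.ofLp)

theorem norm_rotate (R : SO3) (x : E3) : ‖rotate R x‖ = ‖x‖ := by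
  have hR : (R : Matrix (Fin 3) (Fin 3) ℝ)ᵀ * (R : Matrix (Fin 3) (Fin 3) ℝ) = 1 :=
    (Matrix.mem_orthogonalGroup_iff' (Fin 3) ℝ).1
      (Matrix.mem_specialOrthogonalGroup_iff.1 R.2).1
  have key : ∀ y : E3, ‖y‖ ^ 2 = y.ofLp ⬝ᵥ y.ofLp := by
    intro y
    rw [EuclideanSpace.real_norm_sq_eq]
    simp [dotProduct, sq]
  have h2 : ‖rotate R x‖ ^ 2 = ‖x‖ ^ 2 := by
    rw [key, key]
    simp only [rotate]
    rw [Matrix.dotProduct_mulVec, Matrix.vecMul_mulVec, hR, Matrix.vecMul_one]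
  exact (sq_eq_sq₀ (norm_nonneg _) (norm_nonneg _)).1 h2

/-- The action of rotations on the unit sphere. -/
noncomputable def rotateSphere (R : SO3) (x : S2) : S2 :=
  ⟨rotate R x, by
    rw [mem_sphere_zero_iff_norm, norm_rotate]
    exact mem_sphere_zero_iff_norm.1 x.2⟩

/-- The linear representation on `ℝ^d` given by a matrix representation `D : SO(3) → ℝ^{d × d}`. -/
noncomputable def matrixRep {d : ℕ} (D : SO3 →* Matrix (Fin d) (Fin d) ℝ) :
    Representation ℝ SO3 (Fin d → ℝ) :=
  (Matrix.toLinAlgEquiv' : Matrix (Fin d) (Fin d) ℝ ≃ₐ[ℝ] _).toAlgHom.toRingHom.toMonoidHom.comp D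

/-- `D` is (a matrix form of) the irreducible representation of `SO(3)` of order `l`: a continuous
irreducible real matrix representation of dimension `2 l + 1`. No choice of basis is made. -/
structure IsIrrepOfOrder (l : ℕ)
    (D : SO3 →* Matrix (Fin (2 * l + 1)) (Fin (2 * l + 1)) ℝ) : Prop where
  continuous : Continuous fun R : SO3 => D R
  irreducible : (matrixRep D).IsIrreducible

/-- `Y` is a spherical harmonic of order `l` for the matrix representation `D`: an
`SO(3)`-equivariant function from the unit sphere to `ℝ^{2 l + 1}` of norm one.
The component of index `m : Fin (2 * l + 1)` is the one usually indexed by `m - l`. -/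
structure IsSphericalHarmonic (l : ℕ)
    (D : SO3 →* Matrix (Fin (2 * l + 1)) (Fin (2 * l + 1)) ℝ)
    (Y : S2 → EuclideanSpace ℝ (Fin (2 * l + 1))) : Prop where
  equivariant : ∀ (R : SO3) (x : S2) (m : Fin (2 * l + 1)),
    Y (rotateSphere R x) m = ∑ n, D R m n * Y x n
  norm_eq_one : ∀ x : S2, ‖Y x‖ = 1

/-- The polynomial `‖x‖² = x₀² + x₁² + x₂²`. -/
noncomputable def normSqPoly : MvPolynomial (Fin 3) ℝ :=
  ∑ i, MvPolynomial.X i ^ 2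

/-- The space `‖x‖^{2k} · span {P₀, P₁, …}` of polynomials. -/
noncomputable def normPowMulSpan {ι : Type} (k : ℕ) (P : ι → MvPolynomial (Fin 3) ℝ) :
    Submodule ℝ (MvPolynomial (Fin 3) ℝ) :=
  (Submodule.span ℝ (Set.range P)).map (LinearMap.mulLeft ℝ (normSqPoly ^ k))

/-! ### Geometry of the rotation group -/

/-! On the sphere `‖x‖² = 1`, so restricting polynomials identifies the homogeneous ones of degree
`l` with a space `sphPoly l` of functions containing `sphPoly (l - 2)`. Let `harmonic l` be the
`L²`-orthogonal complement of the smaller space in the larger; counting monomials gives it dimension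
`2 l + 1`.

These spaces are simple under rotations (`simple_harmonic`): every nonzero invariant subspace
contains a nonzero zonal function, fixed by the rotations about the polar axis, whereas `harmonic l`
has at most one zonal function up to scalars, since modulo lower degree it is a multiple of the
`l`-th power of the polar coordinate (`zonal_mem`). The action on an orthonormal basis of `harmonic
l` is therefore an orthogonal irreducible representation of order `l`.

Conversely, a simple space of continuous functions of dimension `2 l + 1` must be `harmonic l`
(`Simple.eq_harmonic`): simple spaces of different dimensions are orthogonal, and by
Stone–Weierstrass only `0` is orthogonal to all polynomials. The components of any spherical
harmonic of order `l` span such a space, hence are restrictions of homogeneous polynomials of degree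
`l`. The direct sum decomposition is that of `sphPoly l` into the `harmonic (l - 2 * k)`, pulled
back through the restriction.

A spherical harmonic for an orthogonal `D` is the orbit map of a unit vector fixed by the stabilizer
of the pole. Such a vector exists because the dimension is odd (`exists_unit_rotZ_fixed`). -/

theorem SO3.transpose_mul_self (R : SO3) :
    (R : Matrix (Fin 3) (Fin 3) ℝ)ᵀ * (R : Matrix (Fin 3) (Fin 3) ℝ) = 1 :=
  (Matrix.mem_orthogonalGroup_iff' (Fin 3) ℝ).1 (Matrix.mem_specialOrthogonalGroup_iff.1 R.2).1

theorem SO3.det_eq_one (R : SO3) : (R : Matrix (Fin 3) (Fin 3) ℝ).det = 1 :=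
  (Matrix.mem_specialOrthogonalGroup_iff.1 R.2).2

theorem rotate_apply (R : SO3) (x : E3) (i : Fin 3) :
    rotate R x i = ∑ j, (R : Matrix (Fin 3) (Fin 3) ℝ) i j * x j := rfl

@[simp]
theorem rotate_one (x : E3) : rotate 1 x = x := by
  simp [rotate]

theorem rotate_mul (R S : SO3) (x : E3) : rotate (R * S) x = rotate R (rotate S x) := by
  simp [rotate]

theorem rotate_smul (R : SO3) (c : ℝ) (x : E3) : rotate R (c • x) = c • rotate R x := by
  simp [rotate, Matrix.mulVec_smul]

@[simp]
theorem coe_rotateSphere (R : SO3) (x : S2) : (rotateSphere R x : E3) = rotate R x := rfl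

@[simp]
theorem rotateSphere_one (x : S2) : rotateSphere 1 x = x := Subtype.ext (rotate_one _)

theorem rotateSphere_mul (R S : SO3) (x : S2) :
    rotateSphere (R * S) x = rotateSphere R (rotateSphere S x) :=
  Subtype.ext (rotate_mul _ _ _)

@[simp]
theorem rotateSphere_inv_self (R : SO3) (x : S2) : rotateSphere R⁻¹ (rotateSphere R x) = x := by
  rw [← rotateSphere_mul, inv_mul_cancel, rotateSphere_one]

@[simp]
theorem rotateSphere_self_inv (R : SO3) (x : S2) : rotateSphere R (rotateSphere R⁻¹ x) = x := by
  rw [← rotateSphere_mul, mul_inv_cancel, rotateSphere_one]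

/-- A rotation as a linear isometry of Euclidean space. -/
noncomputable def rotateIsometry (R : SO3) : E3 ≃ₗᵢ[ℝ] E3 where
  toFun := rotate R
  invFun := rotate R⁻¹
  left_inv x := by rw [← rotate_mul, inv_mul_cancel, rotate_one]
  right_inv x := by rw [← rotate_mul, mul_inv_cancel, rotate_one]
  map_add' x y := by simp [rotate, Matrix.mulVec_add]
  map_smul' c x := rotate_smul R c x
  norm_map' := norm_rotate R

@[simp]
theorem rotateIsometry_apply (R : SO3) (x : E3) : rotateIsometry R x = rotate R x := rfl

theorem continuous_rotateSphere_uncurry :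
    Continuous fun p : SO3 × S2 => rotateSphere p.1 p.2 := by
  refine Continuous.subtype_mk ?_ _
  refine (PiLp.continuous_toLp 2 _).comp ?_
  have h1 : Continuous fun p : SO3 × S2 => (p.1 : Matrix (Fin 3) (Fin 3) ℝ) :=
    continuous_subtype_val.comp continuous_fst
  have h2 : Continuous fun p : SO3 × S2 => (p.2 : E3).ofLp :=
    (PiLp.continuous_ofLp 2 _).comp (continuous_subtype_val.comp continuous_snd)
  exact h1.matrix_mulVec h2

theorem continuous_rotateSphere (R : SO3) : Continuous (rotateSphere R) :=
  continuous_rotateSphere_uncurry.comp (Continuous.prodMk_right R)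

theorem SO3.continuous_inv : Continuous fun R : SO3 => R⁻¹ :=
  Continuous.subtype_mk (Continuous.matrix_transpose continuous_subtype_val) _

/-- The north pole of the sphere. -/
noncomputable def northPole : S2 :=
  ⟨EuclideanSpace.single 2 1, by simp⟩

theorem coe_northPole (i : Fin 3) : (northPole : E3) i = if i = 2 then 1 else 0 := by
  simp [northPole]

theorem sphere_sq_add_sq (x : S2) : (x : E3) 0 ^ 2 + (x : E3) 1 ^ 2 + (x : E3) 2 ^ 2 = 1 := by
  have h := mem_sphere_zero_iff_norm.1 x.2
  have h2 := EuclideanSpace.real_norm_sq_eq (x : E3)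
  rw [h, Fin.sum_univ_three] at h2
  linarith

/-- The rotation by the angle `t` about the polar axis. -/
noncomputable def rotZ (t : ℝ) : SO3 :=
  ⟨!![Real.cos t, -Real.sin t, 0; Real.sin t, Real.cos t, 0; 0, 0, 1], by
    rw [Matrix.mem_specialOrthogonalGroup_iff, Matrix.mem_orthogonalGroup_iff]
    constructor
    · ext i j
      fin_cases i <;> fin_cases j <;> simp [Matrix.mul_apply, Fin.sum_univ_three] <;>
        nlinarith [Real.sin_sq_add_cos_sq t]
    · simp [Matrix.det_fin_three]
      nlinarith [Real.sin_sq_add_cos_sq t]⟩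

theorem coe_rotZ (t : ℝ) : (rotZ t : Matrix (Fin 3) (Fin 3) ℝ) =
    !![Real.cos t, -Real.sin t, 0; Real.sin t, Real.cos t, 0; 0, 0, 1] := rfl

theorem rotZ_add (s t : ℝ) : rotZ (s + t) = rotZ s * rotZ t := by
  apply Subtype.ext
  ext i j
  fin_cases i <;> fin_cases j <;>
    simp [coe_rotZ, Matrix.mul_apply, Fin.sum_univ_three, Real.sin_add, Real.cos_add] <;> ring

theorem rotZ_zero : rotZ 0 = 1 := by
  apply Subtype.ext
  ext i j
  fin_cases i <;> fin_cases j <;> simp [coe_rotZ]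

theorem rotZ_two_pi : rotZ (2 * Real.pi) = 1 := by
  apply Subtype.ext
  ext i j
  fin_cases i <;> fin_cases j <;> simp [coe_rotZ]

theorem continuous_rotZ : Continuous rotZ := by
  refine Continuous.subtype_mk (continuous_matrix fun i j => ?_) _
  fin_cases i <;> fin_cases j <;> simp <;> fun_prop

theorem rotZ_northPole (t : ℝ) : rotateSphere (rotZ t) northPole = northPole := by
  apply Subtype.ext
  ext i
  rw [coe_rotateSphere, rotate_apply]
  fin_cases i <;> simp [coe_rotZ, coe_northPole]

theorem exists_cos_sin {a c : ℝ} (h : a ^ 2 + c ^ 2 = 1) :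
    ∃ t, Real.cos t = a ∧ Real.sin t = c := by
  have hn : ‖(⟨a, c⟩ : ℂ)‖ = 1 := by
    rw [Complex.norm_def, Complex.normSq_mk, ← sq, ← sq, h, Real.sqrt_one]
  have h0 : (⟨a, c⟩ : ℂ) ≠ 0 := by
    intro h0
    rw [h0, norm_zero] at hn
    exact zero_ne_one hn
  refine ⟨Complex.arg ⟨a, c⟩, ?_, ?_⟩
  · rw [Complex.cos_arg h0, hn, div_one]
  · rw [Complex.sin_arg, hn, div_one]

/-- The last column is that of the identity, and since rows are unit vectors so is the last row. The
remaining block is a plane rotation. -/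
theorem exists_rotZ_eq (R : SO3) (h : rotateSphere R northPole = northPole) : ∃ t, R = rotZ t := by
  obtain ⟨A, hA⟩ : ∃ A, (R : Matrix (Fin 3) (Fin 3) ℝ) = A := ⟨_, rfl⟩
  have hcol : ∀ i, A i 2 = if i = 2 then 1 else 0 := by
    intro i
    have := congrArg (fun x : S2 => (x : E3) i) h
    simp only [coe_rotateSphere, rotate_apply, coe_northPole, hA] at this
    simpa using this
  have hdet := R.det_eq_one
  have h1 := R.transpose_mul_self
  rw [hA] at hdet h1
  have h1' : A * Aᵀ = 1 := mul_eq_one_comm.1 h1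
  have c0 := hcol 0
  have c1 := hcol 1
  have c2 := hcol 2
  simp at c0 c1 c2
  have e22 := congrFun (congrFun h1' 2) 2
  have e00 := congrFun (congrFun h1 0) 0
  have e01 := congrFun (congrFun h1 0) 1
  have e11 := congrFun (congrFun h1 1) 1
  simp [Matrix.mul_apply, Fin.sum_univ_three, c2] at e22 e00 e01 e11
  have r0 : A 2 0 = 0 := by nlinarith [sq_nonneg (A 2 0), sq_nonneg (A 2 1)]
  have r1 : A 2 1 = 0 := by nlinarith [sq_nonneg (A 2 0), sq_nonneg (A 2 1)]
  simp [r0, r1] at e00 e01 e11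
  simp [Matrix.det_fin_three, c0, c1, c2, r0, r1] at hdet
  obtain ⟨t, ht, ht'⟩ := exists_cos_sin (a := A 0 0) (c := A 1 0) (by linarith)
  refine ⟨t, Subtype.ext ?_⟩
  -- The second column is determined by being orthogonal to the first and by the determinant.
  have d : A 1 1 = A 0 0 := by
    linear_combination (-A 1 1) * e00 + A 0 0 * hdet + A 1 0 * e01
  have b : A 0 1 = -A 1 0 := by
    linear_combination (-A 0 1) * e00 + (-A 1 0) * hdet + A 0 0 * e01
  rw [hA, coe_rotZ, ht, ht']
  ext i j
  fin_cases i <;> fin_cases j <;> simp [c0, c1, c2, r0, r1, d, b]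

/-- The half-turn about the axis spanned by the unit vector `u`. -/
noncomputable def halfTurn (u : Fin 3 → ℝ) (hu : u 0 ^ 2 + u 1 ^ 2 + u 2 ^ 2 = 1) : SO3 :=
  ⟨Matrix.of fun i j => 2 * u i * u j - if i = j then 1 else 0, by
    rw [Matrix.mem_specialOrthogonalGroup_iff, Matrix.mem_orthogonalGroup_iff]
    constructor
    · ext i j
      fin_cases i <;> fin_cases j <;> simp [Matrix.mul_apply, Fin.sum_univ_three]
      · linear_combination 4 * u 0 ^ 2 * hu
      · linear_combination 4 * u 0 * u 1 * hu
      · linear_combination 4 * u 0 * u 2 * hu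
      · linear_combination 4 * u 0 * u 1 * hu
      · linear_combination 4 * u 1 ^ 2 * hu
      · linear_combination 4 * u 1 * u 2 * hu
      · linear_combination 4 * u 0 * u 2 * hu
      · linear_combination 4 * u 1 * u 2 * hu
      · linear_combination 4 * u 2 ^ 2 * hu
    · simp [Matrix.det_fin_three]
      linear_combination 2 * hu⟩

theorem exists_rotateSphere_northPole (x : S2) : ∃ R : SO3, rotateSphere R northPole = x := by
  have hx := sphere_sq_add_sq x
  suffices h : ∃ u : Fin 3 → ℝ, u 0 ^ 2 + u 1 ^ 2 + u 2 ^ 2 = 1 ∧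
      2 * u 0 * u 2 = (x : E3) 0 ∧ 2 * u 1 * u 2 = (x : E3) 1 ∧ 2 * u 2 ^ 2 - 1 = (x : E3) 2 by
    obtain ⟨u, hu, h0, h1, h2⟩ := h
    refine ⟨halfTurn u hu, Subtype.ext ?_⟩
    ext i
    rw [coe_rotateSphere, rotate_apply]
    fin_cases i <;> simp [halfTurn, coe_northPole]
    · exact h0
    · exact h1
    · rw [← h2]; ring
  -- The half-turn about the bisector of the pole and `x` exchanges them. The bisector is `x` plus
  -- the pole, of squared length `2 + 2 x₂`. It vanishes at the south pole, where any horizontal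
  -- axis serves.
  by_cases hz : (x : E3) 2 = -1
  · refine ⟨![1, 0, 0], by simp, ?_, ?_, by simp [hz]⟩ <;> simp <;> nlinarith
  · have hpos : 0 < 2 + 2 * (x : E3) 2 := by
      have : -1 ≤ (x : E3) 2 := by nlinarith
      have := lt_of_le_of_ne this (Ne.symm hz)
      linarith
    have hs := Real.sq_sqrt hpos.le
    have hs0 : Real.sqrt (2 + 2 * (x : E3) 2) ≠ 0 := (Real.sqrt_pos.2 hpos).ne'
    set s := Real.sqrt (2 + 2 * (x : E3) 2)
    refine ⟨![(x : E3) 0 / s, (x : E3) 1 / s, ((x : E3) 2 + 1) / s], ?_, ?_, ?_, ?_⟩ <;>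
      simp <;> field_simp
    · linear_combination hx - hs
    · linear_combination (-(x : E3) 0) * hs
    · linear_combination (-(x : E3) 1) * hs
    · linear_combination (-1 - (x : E3) 2) * hs

instance SO3.compactSpace : CompactSpace SO3 := by
  suffices h : IsCompact ((Matrix.specialOrthogonalGroup (Fin 3) ℝ : Submonoid _) :
      Set (Matrix (Fin 3) (Fin 3) ℝ)) from isCompact_iff_compactSpace.1 h
  have hc : IsCompact (Set.univ.pi fun _ : Fin 3 => Set.univ.pi fun _ : Fin 3 =>
      Set.Icc (-1 : ℝ) 1 : Set (Matrix (Fin 3) (Fin 3) ℝ)) :=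
    isCompact_univ_pi fun _ => isCompact_univ_pi fun _ => isCompact_Icc
  refine hc.of_isClosed_subset ?_ ?_
  · have : ((Matrix.specialOrthogonalGroup (Fin 3) ℝ : Submonoid _) :
        Set (Matrix (Fin 3) (Fin 3) ℝ)) = {A | A * Aᵀ = 1} ∩ {A | A.det = 1} := by
      ext A
      simp [Matrix.mem_specialOrthogonalGroup_iff, Matrix.mem_orthogonalGroup_iff]
    rw [this]
    exact (isClosed_eq (continuous_id.matrix_mul continuous_id.matrix_transpose)
      continuous_const).inter (isClosed_eq continuous_id.matrix_det continuous_const)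
  · intro A hA i _ j _
    have h := (Matrix.mem_orthogonalGroup_iff (Fin 3) ℝ).1
      (Matrix.mem_specialOrthogonalGroup_iff.1 hA).1
    have h2 := congrFun (congrFun h i) i
    rw [Matrix.one_apply_eq] at h2
    have h3 : A i j * A i j ≤ 1 := by
      rw [← h2]
      exact Finset.single_le_sum (f := fun k => A i k * A i k)
        (fun k _ => mul_self_nonneg _) (Finset.mem_univ j)
    exact ⟨by nlinarith, by nlinarith⟩

/-- Compactness of the group makes the orbit map closed. Continuity on the sphere can then be tested
on the group. -/
theorem isQuotientMap_rotateSphere_northPole :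
    Topology.IsQuotientMap fun R : SO3 => rotateSphere R northPole := by
  have hc : Continuous fun R : SO3 => rotateSphere R northPole :=
    continuous_rotateSphere_uncurry.comp (Continuous.prodMk_left northPole)
  exact hc.isClosedMap.isQuotientMap hc exists_rotateSphere_northPole

/-- A continuous function on the reals that is invariant under the shifts by `1` and `2 π` is
constant. -/
theorem eq_of_periodic_one_of_periodic_two_pi {X : Type*} [TopologicalSpace X] [T2Space X]
    {f : ℝ → X} (hf : Continuous f) (h1 : ∀ t, f (t + 1) = f t)
    (h2 : ∀ t, f (t + 2 * Real.pi) = f t) (t : ℝ) : f t = f 0 := by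
  let G : AddSubgroup ℝ :=
    { carrier := {s | ∀ t, f (t + s) = f t}
      zero_mem' := by simp
      add_mem' := fun {a b} ha hb t => by rw [← add_assoc, hb, ha]
      neg_mem' := fun {a} ha t => by rw [← ha (t + -a), neg_add_cancel_right] }
  have hG : AddSubgroup.closure {2 * Real.pi, 1} ≤ G := by
    rw [AddSubgroup.closure_le]
    rintro s (rfl | rfl)
    · exact h2
    · exact h1
  -- The periods `1` and `2 π` have irrational ratio, so the group they generate is dense.
  have hd : Dense (AddSubgroup.closure {2 * Real.pi, 1} : Set ℝ) := by
    rw [dense_addSubgroupClosure_pair_iff, div_one]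
    exact_mod_cast irrational_pi.natCast_mul (m := 2) two_ne_zero
  have := Continuous.ext_on hd hf (continuous_const (y := f 0)) fun s hs => by
    have := hG hs 0
    rwa [zero_add] at this
  exact congrFun this t

/-! ### Continuous functions on the sphere with the `L²` inner product -/

open MeasureTheory in
/-- The rotation invariant measure on the sphere. -/
noncomputable def sphereMeasure : Measure S2 := (volume : Measure E3).toSphere

noncomputable instance : MeasureTheory.IsFiniteMeasure sphereMeasure :=
  inferInstanceAs (MeasureTheory.IsFiniteMeasure
    (MeasureTheory.volume : MeasureTheory.Measure E3).toSphere)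

noncomputable instance : sphereMeasure.IsOpenPosMeasure :=
  inferInstanceAs ((MeasureTheory.volume : MeasureTheory.Measure E3).toSphere.IsOpenPosMeasure)

-- The measure of a set on the sphere is, up to a factor, the volume of the cone over it. Rotations
-- carry cones to cones and preserve volume.
open MeasureTheory Pointwise in
theorem measurePreserving_rotateSphere (R : SO3) :
    MeasurePreserving (rotateSphere R) sphereMeasure sphereMeasure := by
  have hm : Measurable (rotateSphere R) := (continuous_rotateSphere R).measurable
  refine ⟨hm, Measure.ext fun s hs => ?_⟩
  rw [Measure.map_apply hm hs]
  unfold sphereMeasure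
  rw [Measure.toSphere_apply' _ hs, Measure.toSphere_apply' _ (hm hs)]
  congr 1
  conv_rhs => rw [← (rotateIsometry R).measurePreserving.measure_preimage_emb
    (rotateIsometry R).toMeasurableEquiv.measurableEmbedding]
  congr 1
  ext y
  simp only [Set.mem_smul, Set.mem_image, Set.mem_preimage, rotateIsometry_apply]
  constructor
  · rintro ⟨c, hc, _, ⟨x, hx, rfl⟩, rfl⟩
    exact ⟨c, hc, _, ⟨_, hx, rfl⟩, (rotate_smul R c x).symm⟩
  · rintro ⟨c, hc, _, ⟨x, hx, rfl⟩, h⟩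
    refine ⟨c, hc, _, ⟨rotateSphere R⁻¹ x, by simpa using hx, rfl⟩, ?_⟩
    rw [coe_rotateSphere, ← rotate_smul, h, ← rotate_mul, inv_mul_cancel, rotate_one]

/-- Continuous functions on the sphere, to be equipped with the `L²` inner product. -/
def SphereFun : Type := C(S2, ℝ)

namespace SphereFun

noncomputable instance : AddCommGroup SphereFun := inferInstanceAs (AddCommGroup C(S2, ℝ))

noncomputable instance : Module ℝ SphereFun := inferInstanceAs (Module ℝ C(S2, ℝ))

instance : FunLike SphereFun S2 ℝ := inferInstanceAs (FunLike C(S2, ℝ) S2 ℝ)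

theorem continuous (f : SphereFun) : Continuous f := ContinuousMap.continuous (f : C(S2, ℝ))

@[ext]
theorem ext {f g : SphereFun} (h : ∀ x, f x = g x) : f = g := DFunLike.ext f g h

@[simp]
theorem add_apply (f g : SphereFun) (x : S2) : (f + g) x = f x + g x := rfl

@[simp]
theorem sub_apply (f g : SphereFun) (x : S2) : (f - g) x = f x - g x := rfl

@[simp]
theorem smul_apply (c : ℝ) (f : SphereFun) (x : S2) : (c • f) x = c * f x := rfl

@[simp]
theorem zero_apply (x : S2) : (0 : SphereFun) x = 0 := rfl

theorem integrable_of_continuous {f : S2 → ℝ} (hf : Continuous f) :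
    MeasureTheory.Integrable f sphereMeasure :=
  hf.integrable_of_hasCompactSupport (HasCompactSupport.of_compactSpace f)

/-- The `L²` inner product of continuous functions on the sphere. -/
noncomputable abbrev core : InnerProductSpace.Core ℝ SphereFun where
  inner f g := ∫ x, f x * g x ∂sphereMeasure
  conj_inner_symm f g := by simp [mul_comm]
  re_inner_nonneg f := by
    exact MeasureTheory.integral_nonneg fun x => mul_self_nonneg (f x)
  add_left f g h := by
    simp only [add_apply, add_mul]
    exact MeasureTheory.integral_add
      (integrable_of_continuous (f.continuous.mul h.continuous))
      (integrable_of_continuous (g.continuous.mul h.continuous))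
  smul_left f g c := by
    simp only [smul_apply, mul_assoc, MeasureTheory.integral_const_mul]
    rfl
  definite f hf := by
    have hc : Continuous fun x => f x * f x := f.continuous.mul f.continuous
    have h := (MeasureTheory.integral_eq_zero_iff_of_nonneg (fun x => mul_self_nonneg (f x))
      (integrable_of_continuous hc)).1 hf
    have h2 := (hc.ae_eq_iff_eq sphereMeasure continuous_zero).1 h
    ext x
    exact mul_self_eq_zero.1 (congrFun h2 x)

noncomputable instance : NormedAddCommGroup SphereFun := core.toNormedAddCommGroup

noncomputable instance : InnerProductSpace ℝ SphereFun := InnerProductSpace.ofCore core.toCore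

theorem inner_def (f g : SphereFun) : inner ℝ f g = ∫ x, f x * g x ∂sphereMeasure := rfl

/-- Rotations act linearly on functions on the sphere. -/
noncomputable def rot : Representation ℝ SO3 SphereFun where
  toFun R :=
    { toFun := fun f => (⟨fun x => f (rotateSphere R⁻¹ x),
        f.continuous.comp (continuous_rotateSphere R⁻¹)⟩ : C(S2, ℝ))
      map_add' := fun _ _ => rfl
      map_smul' := fun _ _ => rfl }
  map_one' := by
    ext f x
    change f (rotateSphere 1⁻¹ x) = f x
    rw [inv_one, rotateSphere_one]
  map_mul' R S := by
    ext f x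
    change f (rotateSphere (R * S)⁻¹ x) = f (rotateSphere S⁻¹ (rotateSphere R⁻¹ x))
    rw [mul_inv_rev, rotateSphere_mul]

@[simp]
theorem rot_apply (R : SO3) (f : SphereFun) (x : S2) :
    rot R f x = f (rotateSphere R⁻¹ x) := rfl

theorem rot_rot_inv (R : SO3) (f : SphereFun) : rot R (rot R⁻¹ f) = f := by
  ext x
  simp

theorem inner_rot_rot (R : SO3) (f g : SphereFun) :
    inner ℝ (rot R f) (rot R g) = inner ℝ f g := by
  have h := measurePreserving_rotateSphere R⁻¹
  have hg : Continuous fun x => f x * g x := f.continuous.mul g.continuous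
  rw [inner_def, inner_def]
  conv_rhs => rw [← h.map_eq]
  rw [MeasureTheory.integral_map h.measurable.aemeasurable hg.aestronglyMeasurable]
  rfl

theorem inner_rot_left (R : SO3) (f g : SphereFun) :
    inner ℝ (rot R f) g = inner ℝ f (rot R⁻¹ g) := by
  rw [← inner_rot_rot R f, rot_rot_inv]

/-- Matrix coefficients of the action of the rotation group are continuous. -/
theorem continuous_inner_rot (f g : SphereFun) : Continuous fun R : SO3 => inner ℝ f (rot R g) := by
  have : FirstCountableTopology (Matrix (Fin 3) (Fin 3) ℝ) :=
    inferInstanceAs (FirstCountableTopology (Fin 3 → Fin 3 → ℝ))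
  have : FirstCountableTopology SO3 := Topology.IsInducing.subtypeVal.firstCountableTopology
  have h : Continuous fun p : SO3 × S2 => f p.2 * g (rotateSphere p.1⁻¹ p.2) :=
    (f.continuous.comp continuous_snd).mul (g.continuous.comp
      (continuous_rotateSphere_uncurry.comp
        ((SO3.continuous_inv.comp continuous_fst).prodMk continuous_snd)))
  have := continuous_parametric_integral_of_continuous (μ := sphereMeasure)
    (f := fun (R : SO3) (x : S2) => f x * g (rotateSphere R⁻¹ x)) h
    (isCompact_univ : IsCompact (Set.univ : Set S2))
  rw [MeasureTheory.Measure.restrict_univ] at this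
  exact this

/-! ### Rotation invariant spaces of functions -/

/-- A space of functions on the sphere is invariant if it is stable under rotations. -/
def Invariant (U : Submodule ℝ SphereFun) : Prop := ∀ (R : SO3), ∀ f ∈ U, rot R f ∈ U

/-- An invariant space of functions is simple if it has no proper nonzero invariant subspaces. -/
structure Simple (U : Submodule ℝ SphereFun) : Prop where
  invariant : Invariant U
  ne_bot : U ≠ ⊥
  eq_bot_or_eq : ∀ U' ≤ U, Invariant U' → U' = ⊥ ∨ U' = U

theorem Invariant.inf {U V : Submodule ℝ SphereFun} (hU : Invariant U) (hV : Invariant V) :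
    Invariant (U ⊓ V) := fun R f hf => ⟨hU R f hf.1, hV R f hf.2⟩

theorem Invariant.orthogonal {U : Submodule ℝ SphereFun} (hU : Invariant U) : Invariant Uᗮ := by
  intro R f hf
  rw [Submodule.mem_orthogonal'] at hf ⊢
  intro u hu
  rw [inner_rot_left]
  exact hf _ (hU _ _ hu)

/-- The orthogonal projection to `V`, restricted to `U`, has kernel `U ⊓ Vᗮ`. -/
theorem finrank_le_of_inf_orthogonal_eq_bot {U V : Submodule ℝ SphereFun} [FiniteDimensional ℝ U]
    [FiniteDimensional ℝ V] (h : U ⊓ Vᗮ = ⊥) : Module.finrank ℝ U ≤ Module.finrank ℝ V := by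
  refine LinearMap.finrank_le_finrank_of_injective
    (f := (V.orthogonalProjectionOnto : SphereFun →ₗ[ℝ] V) ∘ₗ U.subtype) ?_
  rw [← LinearMap.ker_eq_bot, LinearMap.ker_eq_bot']
  intro u hu
  have hu' : (u : SphereFun) ∈ U ⊓ Vᗮ :=
    ⟨u.2, Submodule.orthogonalProjectionOnto_eq_zero_iff.1 hu⟩
  rw [h, Submodule.mem_bot] at hu'
  exact Subtype.ext hu'

/-- A form of Schur's lemma: `U ⊓ Vᗮ` is invariant, hence `0` or `U`, and likewise with the roles
exchanged. If both vanish, the dimensions agree. -/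
theorem Simple.isOrtho_of_finrank_ne {U V : Submodule ℝ SphereFun} [FiniteDimensional ℝ U]
    [FiniteDimensional ℝ V] (hU : Simple U) (hV : Simple V)
    (h : Module.finrank ℝ U ≠ Module.finrank ℝ V) : U ⟂ V := by
  rcases hU.eq_bot_or_eq _ inf_le_left (hU.invariant.inf hV.invariant.orthogonal) with h1 | h1
  · rcases hV.eq_bot_or_eq _ inf_le_left (hV.invariant.inf hU.invariant.orthogonal) with h2 | h2
    · exact absurd (le_antisymm (finrank_le_of_inf_orthogonal_eq_bot h1)
        (finrank_le_of_inf_orthogonal_eq_bot h2)) h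
    · exact (Submodule.isOrtho_iff_le.2 (inf_eq_left.1 h2)).symm
  · exact Submodule.isOrtho_iff_le.2 (inf_eq_left.1 h1)

/-- Evaluation at a point as a linear functional. -/
def evalAt (x : S2) : SphereFun →ₗ[ℝ] ℝ where
  toFun f := f x
  map_add' _ _ := rfl
  map_smul' _ _ := rfl

/-- By transitivity, a rotation moves any point where `f` is nonzero to the pole. -/
theorem exists_mem_apply_northPole_ne_zero {U : Submodule ℝ SphereFun} (hU : Invariant U)
    (h0 : U ≠ ⊥) : ∃ f ∈ U, f northPole ≠ 0 := by
  obtain ⟨f, hf, hf0⟩ := Submodule.exists_mem_ne_zero_of_ne_bot h0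
  by_contra! hc
  apply hf0
  ext x
  obtain ⟨R, rfl⟩ := exists_rotateSphere_northPole x
  simpa using hc _ (hU R⁻¹ f hf)

/-- A nonzero invariant space contains a nonzero function that is invariant under the rotations
about the polar axis. -/
theorem exists_zonal_mem {U : Submodule ℝ SphereFun} [FiniteDimensional ℝ U] (hU : Invariant U)
    (h0 : U ≠ ⊥) : ∃ z ∈ U, z ≠ 0 ∧ ∀ t, rot (rotZ t) z = z := by
  obtain ⟨f, hf, hf0⟩ := exists_mem_apply_northPole_ne_zero hU h0
  -- The Riesz representer `z` of evaluation at the pole is the zonal function: it is nonzero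
  -- because evaluation is, and it is fixed by `rotZ t` because the pole is.
  let ev : U →L[ℝ] ℝ := LinearMap.toContinuousLinearMap (evalAt northPole ∘ₗ U.subtype)
  let z : U := (InnerProductSpace.toDual ℝ U).symm ev
  have hz : ∀ g ∈ U, inner ℝ (z : SphereFun) g = g northPole := by
    intro g hg
    have := InnerProductSpace.toDual_symm_apply (𝕜 := ℝ) (x := (⟨g, hg⟩ : U)) (y := ev)
    rw [Submodule.coe_inner] at this
    exact this
  refine ⟨z, z.2, ?_, fun t => ?_⟩
  · intro h
    have := hz f hf
    rw [h, inner_zero_left] at this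
    exact hf0 this.symm
  · have hd : rot (rotZ t) (z : SphereFun) - z ∈ U := U.sub_mem (hU _ _ z.2) z.2
    rw [← sub_eq_zero, ← inner_self_eq_zero (𝕜 := ℝ), inner_sub_left, inner_rot_left,
      hz _ (hU _ _ hd), hz _ hd, rot_apply, inv_inv, rotZ_northPole, sub_self]

end SphereFun

/-! ### Homogeneous polynomials in three variables -/

/-- Passing from `n` to `n + 2` adds `2 (n + 2) + 1` to both sides. The subtraction never truncates
in this range of `k`. -/
theorem sum_range_half_two_mul_sub_add_one (l : ℕ) :
    (l + 2) * (l + 1) / 2 = ∑ k ∈ Finset.range (l / 2 + 1), (2 * (l - 2 * k) + 1) := by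
  induction l using Nat.twoStepInduction with
  | zero => simp
  | one => simp
  | more n ih _ =>
    have h : ∀ k, n + 2 - 2 * (k + 1) = n - 2 * k := fun k => by omega
    rw [show (n + 2) / 2 + 1 = (n / 2 + 1) + 1 by omega, Finset.sum_range_succ']
    simp only [h]
    rw [← ih, show (n + 2 + 2) * (n + 2 + 1) = (n + 2) * (n + 1) + 2 * (2 * n + 5) by ring,
      Nat.add_mul_div_left _ _ two_pos]
    omega

/-- The monomials of degree `l` form a basis; stars and bars counts `(l + 2).choose 2` of them. -/
theorem finrank_homogeneousSubmodule_fin_three (l : ℕ) :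
    Module.finrank ℝ (MvPolynomial.homogeneousSubmodule (Fin 3) ℝ l) = (l + 2) * (l + 1) / 2 := by
  let b : (Finset.univ : Finset (Fin 3)).finsuppAntidiag l → MvPolynomial (Fin 3) ℝ :=
    fun d => MvPolynomial.monomial (d : Fin 3 →₀ ℕ) 1
  have hb : LinearIndependent ℝ b := by
    have h := (MvPolynomial.basisMonomials (Fin 3) ℝ).linearIndependent
    rw [MvPolynomial.coe_basisMonomials] at h
    exact h.comp (fun d : (Finset.univ : Finset (Fin 3)).finsuppAntidiag l => (d : Fin 3 →₀ ℕ))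
      Subtype.val_injective
  have hs : MvPolynomial.homogeneousSubmodule (Fin 3) ℝ l = Submodule.span ℝ (Set.range b) := by
    apply le_antisymm
    · intro p hp
      rw [p.as_sum]
      refine Submodule.sum_mem _ fun d hd => ?_
      have hdeg : ∑ i, d i = l := by
        rw [hp.degree_eq_sum_deg_support hd]
        exact (Finset.sum_subset (Finset.subset_univ _) (by simp)).symm
      rw [← mul_one (p.coeff d), ← smul_eq_mul, ← MvPolynomial.smul_monomial]
      refine Submodule.smul_mem _ _ (Submodule.subset_span ⟨⟨d, ?_⟩, rfl⟩)
      simp [hdeg]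
    · rw [Submodule.span_le]
      rintro _ ⟨⟨d, hd⟩, rfl⟩
      refine MvPolynomial.isHomogeneous_monomial _ ?_
      rw [Finset.mem_finsuppAntidiag] at hd
      refine Eq.trans ?_ hd.1
      exact Finset.sum_subset (Finset.subset_univ _) (by simp)
  rw [hs, finrank_span_eq_card hb, Fintype.card_coe, Finset.card_finsuppAntidiag_nat_eq_choose]
  simp only [Finset.card_univ, Fintype.card_fin]
  rw [show 3 + l - 1 = l + 2 by omega, ← Nat.choose_symm_of_eq_add (show l + 2 = 2 + l by omega),
    Nat.choose_two_right, show l + 2 - 1 = l + 1 by omega]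

theorem MvPolynomial.IsHomogeneous.eval_smul {σ R : Type*} [Fintype σ] [CommSemiring R]
    {p : MvPolynomial σ R} {l : ℕ} (hp : p.IsHomogeneous l) (c : R) (x : σ → R) :
    MvPolynomial.eval (c • x) p = c ^ l * MvPolynomial.eval x p := by
  rw [MvPolynomial.eval_eq', MvPolynomial.eval_eq', Finset.mul_sum]
  refine Finset.sum_congr rfl fun d hd => ?_
  have hdeg : ∑ i, d i = l := by
    rw [hp.degree_eq_sum_deg_support hd]
    exact (Finset.sum_subset (Finset.subset_univ _) (by simp)).symm
  simp only [Pi.smul_apply, smul_eq_mul, mul_pow, Finset.prod_mul_distrib,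
    Finset.prod_pow_eq_pow_sum, hdeg]
  ring

theorem exists_eq_norm_smul (x : E3) : ∃ u : S2, x = ‖x‖ • (u : E3) := by
  by_cases hx : x = 0
  · exact ⟨northPole, by simp [hx]⟩
  · refine ⟨⟨‖x‖⁻¹ • x, ?_⟩, ?_⟩
    · rw [mem_sphere_zero_iff_norm, norm_smul, norm_inv, norm_norm,
        inv_mul_cancel₀ (norm_ne_zero_iff.2 hx)]
    · rw [smul_smul, mul_inv_cancel₀ (norm_ne_zero_iff.2 hx), one_smul]

theorem isHomogeneous_normSqPoly : normSqPoly.IsHomogeneous 2 :=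
  MvPolynomial.IsHomogeneous.sum _ _ _ fun i _ => MvPolynomial.isHomogeneous_X_pow i 2

theorem eval_normSqPoly (x : S2) : MvPolynomial.eval (x : E3).ofLp normSqPoly = 1 := by
  simp [normSqPoly, Fin.sum_univ_three, sphere_sq_add_sq x]

/-! ### Restriction of polynomials to the sphere and the spaces `harmonic l` -/

namespace SphereFun

/-- The restriction of polynomials to the sphere. -/
noncomputable def res : MvPolynomial (Fin 3) ℝ →ₗ[ℝ] SphereFun where
  toFun p := (⟨fun x => MvPolynomial.eval (x : E3).ofLp p, (MvPolynomial.continuous_eval p).comp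
    ((PiLp.continuous_ofLp 2 _).comp continuous_subtype_val)⟩ : C(S2, ℝ))
  map_add' p q := by
    ext x
    exact MvPolynomial.eval_add
  map_smul' c p := by
    ext x
    exact MvPolynomial.smul_eval _ _ _

@[simp]
theorem res_apply (p : MvPolynomial (Fin 3) ℝ) (x : S2) :
    res p x = MvPolynomial.eval (x : E3).ofLp p := rfl

/-- Homogeneity extends the vanishing from the sphere along rays to the whole space. -/
theorem eq_zero_of_res_eq_zero {p : MvPolynomial (Fin 3) ℝ} {l : ℕ} (hp : p.IsHomogeneous l)
    (h : res p = 0) : p = 0 := by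
  apply MvPolynomial.funext
  intro x
  obtain ⟨u, hu⟩ := exists_eq_norm_smul (WithLp.toLp 2 x)
  have hx : x = ‖(WithLp.toLp 2 x : E3)‖ • (u : E3).ofLp := congrArg WithLp.ofLp hu
  rw [hx, hp.eval_smul, ← res_apply, h, zero_apply, mul_zero, map_zero]

theorem res_normSqPoly_pow_mul (k : ℕ) (p : MvPolynomial (Fin 3) ℝ) :
    res (normSqPoly ^ k * p) = res p := by
  ext x
  simp [eval_normSqPoly]

/-- The restrictions to the sphere of the homogeneous polynomials of degree `l`. -/
noncomputable def sphPoly (l : ℕ) : Submodule ℝ SphereFun :=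
  (MvPolynomial.homogeneousSubmodule (Fin 3) ℝ l).map res

theorem res_mem_sphPoly {l : ℕ} {p : MvPolynomial (Fin 3) ℝ} (hp : p.IsHomogeneous l) :
    res p ∈ sphPoly l := Submodule.mem_map_of_mem hp

theorem finiteDimensional_homogeneousSubmodule (l : ℕ) :
    FiniteDimensional ℝ (MvPolynomial.homogeneousSubmodule (Fin 3) ℝ l) :=
  Module.Finite.iff_fg.2 (MvPolynomial.homogeneousSubmodule_fg (Fin 3) ℝ l)

instance (l : ℕ) : FiniteDimensional ℝ (sphPoly l) :=
  Module.Finite.iff_fg.2 ((MvPolynomial.homogeneousSubmodule_fg (Fin 3) ℝ l).map res)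

theorem injOn_res (l : ℕ) : Set.InjOn res (MvPolynomial.homogeneousSubmodule (Fin 3) ℝ l) := by
  intro p hp q hq h
  rw [← sub_eq_zero]
  exact eq_zero_of_res_eq_zero (MvPolynomial.IsHomogeneous.sub hp hq) (by rw [map_sub, h, sub_self])

theorem finrank_sphPoly (l : ℕ) : Module.finrank ℝ (sphPoly l) = (l + 2) * (l + 1) / 2 := by
  rw [← finrank_homogeneousSubmodule_fin_three l]
  refine (LinearEquiv.finrank_eq (LinearEquiv.ofBijective
    (res.submoduleMap (MvPolynomial.homogeneousSubmodule (Fin 3) ℝ l)) ⟨?_, ?_⟩)).symm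
  · intro p q h
    exact Subtype.ext (injOn_res l p.2 q.2 (congrArg Subtype.val h))
  · exact LinearMap.submoduleMap_surjective _ _

theorem sphPoly_le_add_two (l : ℕ) : sphPoly l ≤ sphPoly (l + 2) := by
  rintro _ ⟨p, hp, rfl⟩
  rw [← res_normSqPoly_pow_mul 1, pow_one, add_comm]
  exact res_mem_sphPoly (isHomogeneous_normSqPoly.mul hp)

theorem invariant_sphPoly (l : ℕ) : Invariant (sphPoly l) := by
  rintro R _ ⟨p, hp, rfl⟩
  -- The linear forms of `R⁻¹ x`; substituting them into `p` preserves the degree.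
  let g : Fin 3 → MvPolynomial (Fin 3) ℝ := fun i =>
    ∑ j, MvPolynomial.C (((R⁻¹ : SO3) : Matrix (Fin 3) (Fin 3) ℝ) i j) * MvPolynomial.X j
  have hg : ∀ i, (g i).IsHomogeneous 1 := fun i =>
    MvPolynomial.IsHomogeneous.sum _ _ _ fun j _ => MvPolynomial.isHomogeneous_C_mul_X _ _
  have h : (MvPolynomial.aeval g p).IsHomogeneous l := by
    simpa using MvPolynomial.IsHomogeneous.aeval hp g hg
  refine ⟨MvPolynomial.aeval g p, h, ?_⟩
  ext x
  rw [res_apply, rot_apply, res_apply]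
  have h1 : MvPolynomial.eval (x : E3).ofLp (MvPolynomial.aeval g p) =
      MvPolynomial.eval (fun i => MvPolynomial.eval (x : E3).ofLp (g i)) p :=
    MvPolynomial.eval₂Hom_bind₁ (RingHom.id ℝ) _ g p
  rw [h1]
  congr 2
  ext i
  simp only [g, map_sum, map_mul, MvPolynomial.eval_C, MvPolynomial.eval_X]
  rfl

/-- Continuity here is for the uniform norm, as Stone–Weierstrass requires; the integral factors
through the continuous map into `L²`. -/
theorem continuous_integral_mul (f : C(S2, ℝ)) :
    Continuous fun g : C(S2, ℝ) => ∫ x, f x * g x ∂sphereMeasure := by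
  have h : Continuous fun g : C(S2, ℝ) => inner ℝ
      (ContinuousMap.toLp (p := 2) sphereMeasure ℝ f)
      (ContinuousMap.toLp (p := 2) sphereMeasure ℝ g) :=
    continuous_const.inner (ContinuousLinearMap.continuous _)
  refine h.congr fun g => ?_
  rw [MeasureTheory.ContinuousMap.inner_toLp]
  simp_rw [mul_comm]
  rfl

/-- A continuous function that is orthogonal to all polynomials vanishes. -/
theorem eq_zero_of_forall_inner_res_eq_zero {f : SphereFun}
    (h : ∀ p, inner ℝ f (res p) = 0) : f = 0 := by
  -- The coordinates separate points, so polynomials are uniformly dense. The functions orthogonal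
  -- to `f` form a closed set containing them, hence containing `f` itself.
  let φ : MvPolynomial (Fin 3) ℝ →ₐ[ℝ] C(S2, ℝ) := AlgHom.ofLinearMap res
    (by ext x; exact map_one (MvPolynomial.eval (x : E3).ofLp))
    (fun p q => by ext x; exact map_mul (MvPolynomial.eval (x : E3).ofLp) p q)
  have hd : φ.range.topologicalClosure = ⊤ := by
    apply ContinuousMap.subalgebra_topologicalClosure_eq_top_of_separatesPoints
    intro x y hxy
    obtain ⟨i, hi⟩ : ∃ i, (x : E3) i ≠ (y : E3) i := by
      by_contra! hc
      exact hxy (Subtype.ext (PiLp.ext hc))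
    refine ⟨_, ⟨φ (MvPolynomial.X i), ⟨_, rfl⟩, rfl⟩, ?_⟩
    change MvPolynomial.eval (x : E3).ofLp (MvPolynomial.X i) ≠
      MvPolynomial.eval (y : E3).ofLp (MvPolynomial.X i)
    simpa using hi
  have hclosed : IsClosed {g : C(S2, ℝ) | ∫ x, f x * g x ∂sphereMeasure = 0} :=
    isClosed_eq (continuous_integral_mul f) continuous_const
  have hf : (f : C(S2, ℝ)) ∈ φ.range.topologicalClosure := by
    rw [hd]
    trivial
  have hsub : (φ.range : Set C(S2, ℝ)) ⊆ {g : C(S2, ℝ) | ∫ x, f x * g x ∂sphereMeasure = 0} := by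
    rintro _ ⟨p, rfl⟩
    exact h p
  exact inner_self_eq_zero (𝕜 := ℝ).1 (closure_minimal hsub hclosed hf)

theorem eq_zero_of_forall_mem_orthogonal_sphPoly {f : SphereFun}
    (h : ∀ l, f ∈ (sphPoly l)ᗮ) : f = 0 := by
  refine eq_zero_of_forall_inner_res_eq_zero fun p => ?_
  rw [← p.sum_homogeneousComponent, map_sum, inner_sum]
  exact Finset.sum_eq_zero fun k _ => (Submodule.mem_orthogonal' _ _).1 (h k) _
    (res_mem_sphPoly (MvPolynomial.homogeneousComponent_isHomogeneous k p))

/-- The restrictions to the sphere of the homogeneous polynomials of degree `l - 2`. -/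
noncomputable def lowerSphPoly : ℕ → Submodule ℝ SphereFun
  -- Nothing lies below degrees `0` and `1`; a truncated `l - 2` would wrongly give the constants.
  | 0 => ⊥
  | 1 => ⊥
  | l + 2 => sphPoly l

instance (l : ℕ) : FiniteDimensional ℝ (lowerSphPoly l) := by
  match l with
  | 0 => exact inferInstanceAs (FiniteDimensional ℝ (⊥ : Submodule ℝ SphereFun))
  | 1 => exact inferInstanceAs (FiniteDimensional ℝ (⊥ : Submodule ℝ SphereFun))
  | l + 2 => exact inferInstanceAs (FiniteDimensional ℝ (sphPoly l))

theorem lowerSphPoly_le (l : ℕ) : lowerSphPoly l ≤ sphPoly l := by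
  match l with
  | 0 => exact bot_le
  | 1 => exact bot_le
  | l + 2 => exact sphPoly_le_add_two l

theorem invariant_bot : Invariant ⊥ := by
  intro R f hf
  rw [Submodule.mem_bot] at hf ⊢
  rw [hf, map_zero]

theorem invariant_lowerSphPoly (l : ℕ) : Invariant (lowerSphPoly l) := by
  match l with
  | 0 => exact invariant_bot
  | 1 => exact invariant_bot
  | l + 2 => exact invariant_sphPoly l

/-- The space of spherical harmonics of order `l`: the restrictions to the sphere of the
homogeneous polynomials of degree `l` that are orthogonal to those of degree `l - 2`. -/
noncomputable def harmonic (l : ℕ) : Submodule ℝ SphereFun := sphPoly l ⊓ (lowerSphPoly l)ᗮ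

instance (l : ℕ) : FiniteDimensional ℝ (harmonic l) :=
  Submodule.finiteDimensional_of_le (inf_le_left : harmonic l ≤ sphPoly l)

theorem invariant_harmonic (l : ℕ) : Invariant (harmonic l) :=
  (invariant_sphPoly l).inf (invariant_lowerSphPoly l).orthogonal

theorem lowerSphPoly_sup_harmonic (l : ℕ) : lowerSphPoly l ⊔ harmonic l = sphPoly l := by
  rw [harmonic, inf_comm]
  exact Submodule.sup_orthogonal_inf_of_hasOrthogonalProjection (lowerSphPoly_le l)

theorem finrank_harmonic (l : ℕ) : Module.finrank ℝ (harmonic l) = 2 * l + 1 := by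
  have h : Module.finrank ℝ (lowerSphPoly l) + Module.finrank ℝ (harmonic l) =
      Module.finrank ℝ (sphPoly l) := by
    rw [harmonic, inf_comm]
    exact Submodule.finrank_add_inf_finrank_orthogonal (lowerSphPoly_le l)
  rw [finrank_sphPoly] at h
  match l with
  | 0 =>
    have h0 : Module.finrank ℝ (lowerSphPoly 0) = 0 := finrank_bot ℝ SphereFun
    simpa [h0] using h
  | 1 =>
    have h0 : Module.finrank ℝ (lowerSphPoly 1) = 0 := finrank_bot ℝ SphereFun
    simpa [h0] using h
  | l + 2 =>
    have h0 : Module.finrank ℝ (lowerSphPoly (l + 2)) = (l + 2) * (l + 1) / 2 := finrank_sphPoly l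
    rw [h0, show (l + 2 + 2) * (l + 2 + 1) = (l + 2) * (l + 1) + 2 * (2 * l + 5) by ring,
      Nat.add_mul_div_left _ _ two_pos] at h
    omega

theorem harmonic_ne_bot (l : ℕ) : harmonic l ≠ ⊥ := by
  intro h
  have := finrank_harmonic l
  rw [h, finrank_bot] at this
  omega

/-! ### Zonal functions -/

/-- On the sphere `x₀² + x₁² = 1 - x₂²`. Each use trades a factor for `x₂²`, up to a sign and a term
of degree `l - 2`. -/
theorem res_zonal_mem (l k j : ℕ) (h : 2 * k + j = l) :
    res ((MvPolynomial.X 0 ^ 2 + MvPolynomial.X 1 ^ 2) ^ k * MvPolynomial.X 2 ^ j) ∈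
      Submodule.span ℝ {res (MvPolynomial.X 2 ^ l)} ⊔ lowerSphPoly l := by
  induction k generalizing j with
  | zero =>
    obtain rfl : j = l := by omega
    rw [pow_zero, one_mul]
    exact Submodule.mem_sup_left (Submodule.mem_span_singleton_self _)
  | succ k ih =>
    obtain ⟨n, rfl⟩ : ∃ n, l = n + 2 := ⟨2 * k + j, by omega⟩
    have h1 := ih (j + 2) (by omega)
    have hh : ((MvPolynomial.X 0 ^ 2 + MvPolynomial.X 1 ^ 2) ^ k * MvPolynomial.X 2 ^ j :
        MvPolynomial (Fin 3) ℝ).IsHomogeneous n := by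
      have := (((MvPolynomial.isHomogeneous_X_pow (R := ℝ) (0 : Fin 3) 2).add
        (MvPolynomial.isHomogeneous_X_pow 1 2)).pow k).mul (MvPolynomial.isHomogeneous_X_pow 2 j)
      rwa [show 2 * k + j = n by omega] at this
    have h2 : res ((MvPolynomial.X 0 ^ 2 + MvPolynomial.X 1 ^ 2) ^ k * MvPolynomial.X 2 ^ j) ∈
        Submodule.span ℝ {res (MvPolynomial.X 2 ^ (n + 2))} ⊔ lowerSphPoly (n + 2) :=
      Submodule.mem_sup_right (res_mem_sphPoly hh)
    have h3 : res ((MvPolynomial.X 0 ^ 2 + MvPolynomial.X 1 ^ 2) ^ (k + 1) *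
          MvPolynomial.X 2 ^ j) =
        res ((MvPolynomial.X 0 ^ 2 + MvPolynomial.X 1 ^ 2) ^ k * MvPolynomial.X 2 ^ j) -
        res ((MvPolynomial.X 0 ^ 2 + MvPolynomial.X 1 ^ 2) ^ k * MvPolynomial.X 2 ^ (j + 2)) := by
      ext x
      have hx := sphere_sq_add_sq x
      simp only [sub_apply, res_apply, map_mul, map_pow, map_add, MvPolynomial.eval_X]
      linear_combination (((x : E3) 0 ^ 2 + (x : E3) 1 ^ 2) ^ k * (x : E3) 2 ^ j) * hx
    rw [h3]
    exact Submodule.sub_mem _ h2 h1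

/-- The point of the sphere with the given coordinates. -/
noncomputable def spherePoint (a b c : ℝ) (h : a ^ 2 + b ^ 2 + c ^ 2 = 1) : S2 :=
  ⟨WithLp.toLp 2 ![a, b, c], by
    rw [mem_sphere_zero_iff_norm, ← sq_eq_sq₀ (norm_nonneg _) zero_le_one,
      EuclideanSpace.real_norm_sq_eq]
    simpa [Fin.sum_univ_three] using h⟩

theorem apply_eq_of_rotZ_invariant {f : SphereFun} (hf : ∀ t, rot (rotZ t) f = f) (x : S2)
    {r t : ℝ} (h0 : r * Real.cos t = (x : E3) 0) (h1 : r * Real.sin t = (x : E3) 1)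
    (h : r ^ 2 + 0 ^ 2 + (x : E3) 2 ^ 2 = 1) :
    f x = f (spherePoint r 0 ((x : E3) 2) h) := by
  have hx : rotateSphere (rotZ t)⁻¹ x = spherePoint r 0 ((x : E3) 2) h := by
    have : x = rotateSphere (rotZ t) (spherePoint r 0 ((x : E3) 2) h) := by
      apply Subtype.ext
      ext i
      rw [coe_rotateSphere, rotate_apply]
      fin_cases i <;> simp [coe_rotZ, Fin.sum_univ_three, spherePoint]
      · rw [← h0, mul_comm]
      · rw [← h1, mul_comm]
    conv_lhs => rw [this]
    rw [rotateSphere_inv_self]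
  rw [← hx, ← rot_apply, hf]

/-- Modulo polynomials of lower degree, a polynomial on the sphere that is invariant under the
rotations about the polar axis is a multiple of the power of the polar coordinate. -/
theorem zonal_mem {l : ℕ} {f : SphereFun} (hf : f ∈ sphPoly l)
    (hinv : ∀ t, rot (rotZ t) f = f) :
    f ∈ Submodule.span ℝ {res (MvPolynomial.X 2 ^ l)} ⊔ lowerSphPoly l := by
  obtain ⟨p, hp, rfl⟩ := hf
  -- With `r² = x₀² + x₁²`, invariance gives `f` at `x` the same value as at `(r, 0, x₂)` and `(-r,
  -- 0, x₂)`, so it is their average. In that average a monomial survives only if its exponent in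
  -- `x₁` is zero and its exponent in `x₀` is even, and it is then polynomial in `r²` and `x₂`.
  let g : (Fin 3 →₀ ℕ) → SphereFun := fun d =>
    if d 1 = 0 ∧ Even (d 0) then
      res ((MvPolynomial.X 0 ^ 2 + MvPolynomial.X 1 ^ 2) ^ (d 0 / 2) * MvPolynomial.X 2 ^ d 2)
    else 0
  have hsum : res p = ∑ d ∈ p.support, p.coeff d • g d := by
    ext x
    let w : ℂ := ⟨(x : E3) 0, (x : E3) 1⟩
    have hw : ‖w‖ ^ 2 = (x : E3) 0 ^ 2 + (x : E3) 1 ^ 2 := by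
      rw [Complex.sq_norm, Complex.normSq_mk]
      ring
    have hx := sphere_sq_add_sq x
    have e1 : res p x = res p (spherePoint ‖w‖ 0 ((x : E3) 2) (by linarith)) :=
      apply_eq_of_rotZ_invariant hinv x (t := w.arg)
        (Complex.norm_mul_cos_arg w) (Complex.norm_mul_sin_arg w) _
    have e2 : res p x = res p (spherePoint (-‖w‖) 0 ((x : E3) 2) (by linarith [neg_sq ‖w‖])) :=
      apply_eq_of_rotZ_invariant hinv x (t := w.arg + Real.pi)
        (by rw [Real.cos_add_pi, neg_mul_neg]; exact Complex.norm_mul_cos_arg w)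
        (by rw [Real.sin_add_pi, neg_mul_neg]; exact Complex.norm_mul_sin_arg w) _
    have e3 : res p x = (res p (spherePoint ‖w‖ 0 ((x : E3) 2) (by linarith)) +
        res p (spherePoint (-‖w‖) 0 ((x : E3) 2) (by linarith [neg_sq ‖w‖]))) / 2 := by
      rw [← e1, ← e2]
      ring
    change _ = evalAt x (∑ d ∈ p.support, p.coeff d • g d)
    rw [e3, res_apply, res_apply, MvPolynomial.eval_eq', MvPolynomial.eval_eq',
      ← Finset.sum_add_distrib, Finset.sum_div, map_sum]
    refine Finset.sum_congr rfl fun d _ => ?_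
    change _ = p.coeff d * g d x
    rw [← mul_add, mul_div_assoc]
    congr 1
    simp only [Fin.prod_univ_three, spherePoint]
    simp only [Matrix.cons_val_zero, Matrix.cons_val_one, Matrix.cons_val]
    by_cases hd1 : d 1 = 0
    · by_cases hd0 : Even (d 0)
      · simp only [g, hd1, hd0, and_self, if_true, res_apply, map_mul, map_pow, map_add,
          MvPolynomial.eval_X, pow_zero, mul_one, hd0.neg_pow, ← hw, ← pow_mul,
          Nat.two_mul_div_two_of_even hd0]
        ring
      · simp only [g, hd1, hd0, and_false, if_false, zero_apply, pow_zero, mul_one,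
          (Nat.not_even_iff_odd.1 hd0).neg_pow]
        ring
    · simp [g, hd1]
  rw [hsum]
  refine Submodule.sum_mem _ fun d hd => Submodule.smul_mem _ _ ?_
  by_cases hc : d 1 = 0 ∧ Even (d 0)
  · simp only [g, hc, and_self, if_true]
    apply res_zonal_mem
    have hdeg : ∑ i, d i = l := by
      rw [hp.degree_eq_sum_deg_support hd]
      exact (Finset.sum_subset (Finset.subset_univ _) (by simp)).symm
    rw [Fin.sum_univ_three] at hdeg
    rw [Nat.two_mul_div_two_of_even hc.2]
    omega
  · simp only [g, hc, if_false]
    exact Submodule.zero_mem _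

theorem simple_harmonic (l : ℕ) : Simple (harmonic l) := by
  refine ⟨invariant_harmonic l, harmonic_ne_bot l, fun U hU hinv => ?_⟩
  by_contra! hc
  obtain ⟨h1, h2⟩ := hc
  have : FiniteDimensional ℝ U := Submodule.finiteDimensional_of_le hU
  have hV : Uᗮ ⊓ harmonic l ≠ ⊥ := by
    intro h
    have h3 := Submodule.sup_orthogonal_inf_of_hasOrthogonalProjection hU
    rw [h, sup_bot_eq] at h3
    exact h2 h3
  have : FiniteDimensional ℝ ↥(Uᗮ ⊓ harmonic l) :=
    Submodule.finiteDimensional_of_le (inf_le_right : Uᗮ ⊓ harmonic l ≤ harmonic l)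
  obtain ⟨z, hz, hz0, hzt⟩ := exists_zonal_mem hinv h1
  obtain ⟨y, hy, hy0, hyt⟩ := exists_zonal_mem (hinv.orthogonal.inf (invariant_harmonic l)) hV
  obtain ⟨a, ha, q, hq, hzq⟩ := Submodule.mem_sup.1 (zonal_mem (hU hz).1 hzt)
  obtain ⟨b, hb, s, hs, hys⟩ := Submodule.mem_sup.1 (zonal_mem hy.2.1 hyt)
  obtain ⟨a, rfl⟩ := Submodule.mem_span_singleton.1 ha
  obtain ⟨b, rfl⟩ := Submodule.mem_span_singleton.1 hb
  -- This combination cancels the power of `x₂`, so it lies both in `lowerSphPoly l` and in its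
  -- orthogonal complement. As `z` and `y` are orthogonal, pairing with `z` forces `b = 0`, which
  -- puts `y` in the lower space too.
  have h0 : b • z - a • y = 0 := by
    have hm : b • z - a • y ∈ harmonic l :=
      Submodule.sub_mem _ (Submodule.smul_mem _ _ (hU hz)) (Submodule.smul_mem _ _ hy.2)
    have hm' : b • z - a • y ∈ lowerSphPoly l := by
      have : b • z - a • y = b • q - a • s := by
        rw [← hzq, ← hys, smul_add, smul_add, smul_comm a b]
        abel
      rw [this]
      exact Submodule.sub_mem _ (Submodule.smul_mem _ _ hq) (Submodule.smul_mem _ _ hs)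
    exact inner_self_eq_zero (𝕜 := ℝ).1 ((Submodule.mem_orthogonal _ _).1 hm.2 _ hm')
  have hzy : inner ℝ z y = 0 := (Submodule.mem_orthogonal _ _).1 hy.1 z hz
  have hb0 : b = 0 := by
    have h := congrArg (inner ℝ z) h0
    rw [inner_sub_right, inner_smul_right, inner_smul_right, hzy, mul_zero, sub_zero,
      inner_zero_right] at h
    exact (mul_eq_zero.1 h).resolve_right (inner_self_ne_zero.2 hz0)
  apply hy0
  have hlow : y ∈ lowerSphPoly l := by
    rw [← hys, hb0, zero_smul, zero_add]
    exact hs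
  exact inner_self_eq_zero (𝕜 := ℝ).1 ((Submodule.mem_orthogonal _ _).1 hy.2.2 _ hlow)

/-- Simple invariant spaces of continuous functions on the sphere of dimension `2 l + 1` consist
of the spherical harmonics of order `l`. -/
theorem Simple.eq_harmonic {W : Submodule ℝ SphereFun} [FiniteDimensional ℝ W] {l : ℕ}
    (hW : Simple W) (h : Module.finrank ℝ W = 2 * l + 1) : W = harmonic l := by
  have hle : W ≤ harmonic l := by
    intro w hw
    -- The defect `w` minus its projection is orthogonal to every `harmonic k`: for `k = l` by
    -- projection, otherwise because the dimensions differ.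
    have hperp : ∀ k, w - (harmonic l).starProjection w ∈ (harmonic k)ᗮ := by
      intro k
      by_cases hk : k = l
      · subst hk
        exact Submodule.sub_starProjection_mem_orthogonal w
      · have h1 : W ⟂ harmonic k := hW.isOrtho_of_finrank_ne (simple_harmonic k) (by
          rw [h, finrank_harmonic]; omega)
        have h2 : harmonic l ⟂ harmonic k :=
          (simple_harmonic l).isOrtho_of_finrank_ne (simple_harmonic k) (by
            rw [finrank_harmonic, finrank_harmonic]; omega)
        exact Submodule.sub_mem _ (h1 hw) (h2 (Submodule.starProjection_apply_mem _ w))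
    have hall : ∀ k, w - (harmonic l).starProjection w ∈ (sphPoly k)ᗮ := by
      intro k
      induction k using Nat.twoStepInduction with
      | zero =>
        rw [← lowerSphPoly_sup_harmonic, ← Submodule.inf_orthogonal]
        exact ⟨by simp [lowerSphPoly], hperp 0⟩
      | one =>
        rw [← lowerSphPoly_sup_harmonic, ← Submodule.inf_orthogonal]
        exact ⟨by simp [lowerSphPoly], hperp 1⟩
      | more k ih _ =>
        rw [← lowerSphPoly_sup_harmonic, ← Submodule.inf_orthogonal]
        exact ⟨ih, hperp _⟩
    rw [sub_eq_zero.1 (eq_zero_of_forall_mem_orthogonal_sphPoly hall)]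
    exact Submodule.starProjection_apply_mem _ w
  exact Submodule.eq_of_le_of_finrank_eq hle (by rw [h, finrank_harmonic])

end SphereFun

/-! ### Irreducible matrix representations -/

section MatrixRep

variable {d : ℕ} {D : SO3 →* Matrix (Fin d) (Fin d) ℝ}

theorem isIrreducible_matrixRep [Nonempty (Fin d)]
    (h : ∀ U : Submodule ℝ (Fin d → ℝ), (∀ R, ∀ v ∈ U, D R *ᵥ v ∈ U) → U = ⊥ ∨ U = ⊤) :
    (matrixRep D).IsIrreducible := by
  refine { exists_pair_ne := ⟨⊥, ⊤, fun hbt => ?_⟩, eq_bot_or_eq_top := fun U => ?_ }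
  · exact bot_ne_top (α := Submodule ℝ (Fin d → ℝ))
      (congrArg Subrepresentation.toSubmodule hbt)
  · exact (h U.toSubmodule fun R v hv => U.apply_mem_toSubmodule R hv).imp
      (fun h => Subrepresentation.toSubmodule_injective h)
      (fun h => Subrepresentation.toSubmodule_injective h)

theorem eq_bot_or_eq_top_of_isIrreducible (hD : (matrixRep D).IsIrreducible)
    (U : Submodule ℝ (Fin d → ℝ)) (hU : ∀ R, ∀ v ∈ U, D R *ᵥ v ∈ U) : U = ⊥ ∨ U = ⊤ :=
  (hD.eq_bot_or_eq_top ⟨U, fun R _ hv => hU R _ hv⟩).imp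
    (fun h => congrArg Subrepresentation.toSubmodule h)
    (fun h => congrArg Subrepresentation.toSubmodule h)

/-- The dual of an irreducible representation is irreducible. -/
theorem eq_bot_or_eq_top_of_isIrreducible_dual (hD : (matrixRep D).IsIrreducible)
    (U : Submodule ℝ (Fin d → ℝ)) (hU : ∀ R, ∀ v ∈ U, v ᵥ* D R ∈ U) : U = ⊥ ∨ U = ⊤ := by
  -- The annihilator of `U` under the dot product is stable under `D`, so irreducibility applies to
  -- it.
  let A : Submodule ℝ (Fin d → ℝ) :=
    { carrier := {v | ∀ w ∈ U, w ⬝ᵥ v = 0}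
      zero_mem' := fun w _ => dotProduct_zero w
      add_mem' := fun {a b} ha hb w hw => by rw [dotProduct_add, ha w hw, hb w hw, add_zero]
      smul_mem' := fun c a ha w hw => by rw [dotProduct_smul, ha w hw, smul_zero] }
  have hA : ∀ R, ∀ v ∈ A, D R *ᵥ v ∈ A := by
    intro R v hv w hw
    rw [Matrix.dotProduct_mulVec]
    exact hv _ (hU R w hw)
  rcases eq_bot_or_eq_top_of_isIrreducible hD A hA with h | h
  · right
    by_contra hne
    obtain ⟨f, hf, hle⟩ := Submodule.exists_le_ker_of_lt_top U (lt_top_iff_ne_top.2 hne)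
    have hf' : ∀ w, f w = w ⬝ᵥ fun i => f (Pi.single i 1) := by
      intro w
      conv_lhs => rw [pi_eq_sum_univ' w]
      simp [dotProduct, Pi.single]
    have hm : (fun i => f (Pi.single i 1)) ∈ A := fun w hw => by
      rw [← hf']
      exact hle hw
    rw [h, Submodule.mem_bot] at hm
    refine hf (LinearMap.ext fun w => ?_)
    rw [hf', hm, dotProduct_zero, LinearMap.zero_apply]
  · left
    rw [eq_bot_iff]
    intro w hw
    have : w ∈ A := by
      rw [h]
      trivial
    exact dotProduct_self_eq_zero.1 (this w hw)

end MatrixRep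

namespace SphereFun

/-! ### Existence of irreducible representations -/

/-- An orthonormal basis of the space of spherical harmonics of order `l`. -/
noncomputable def harmonicBasis (l : ℕ) : OrthonormalBasis (Fin (2 * l + 1)) ℝ (harmonic l) :=
  (stdOrthonormalBasis ℝ (harmonic l)).reindex (finCongr (finrank_harmonic l))

/-- The basis functions, as functions on the sphere. -/
noncomputable def harmonicFun (l : ℕ) (m : Fin (2 * l + 1)) : SphereFun := harmonicBasis l m

theorem harmonicFun_mem (l : ℕ) (m : Fin (2 * l + 1)) : harmonicFun l m ∈ harmonic l :=
  (harmonicBasis l m).2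

theorem inner_harmonicFun (l : ℕ) (m n : Fin (2 * l + 1)) :
    inner ℝ (harmonicFun l m) (harmonicFun l n) = if m = n then 1 else 0 :=
  orthonormal_iff_ite.1 (harmonicBasis l).orthonormal m n

theorem sum_inner_smul_harmonicFun {l : ℕ} {f : SphereFun} (hf : f ∈ harmonic l) :
    ∑ m, inner ℝ (harmonicFun l m) f • harmonicFun l m = f := by
  have := congrArg (harmonic l).subtype ((harmonicBasis l).sum_repr' ⟨f, hf⟩)
  rw [map_sum] at this
  exact this

theorem inner_eq_sum_harmonicFun {l : ℕ} (g : SphereFun) {f : SphereFun} (hf : f ∈ harmonic l) :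
    inner ℝ g f = ∑ m, inner ℝ g (harmonicFun l m) * inner ℝ (harmonicFun l m) f := by
  conv_lhs => rw [← sum_inner_smul_harmonicFun hf, inner_sum]
  exact Finset.sum_congr rfl fun m _ => by rw [inner_smul_right, mul_comm]

/-- The matrices of the rotations acting on the spherical harmonics of order `l`. -/
noncomputable def harmonicRep (l : ℕ) : SO3 →* Matrix (Fin (2 * l + 1)) (Fin (2 * l + 1)) ℝ where
  toFun R := Matrix.of fun m n => inner ℝ (harmonicFun l m) (rot R (harmonicFun l n))
  map_one' := by
    ext m n
    simp [inner_harmonicFun, Matrix.one_apply]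
  map_mul' R S := by
    ext m n
    simp only [Matrix.of_apply, Matrix.mul_apply, map_mul, Module.End.mul_apply]
    -- With `R` moved to the left factor, expanding `rot S (harmonicFun l n)` in the orthonormal
    -- basis gives the matrix product.
    rw [← inv_inv R, ← inner_rot_left,
      inner_eq_sum_harmonicFun _ (invariant_harmonic l S _ (harmonicFun_mem l n))]
    simp only [inner_rot_left]

theorem harmonicRep_apply (l : ℕ) (R : SO3) (m n : Fin (2 * l + 1)) :
    harmonicRep l R m n = inner ℝ (harmonicFun l m) (rot R (harmonicFun l n)) := rfl

theorem harmonicRep_mem_orthogonalGroup (l : ℕ) (R : SO3) :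
    harmonicRep l R ∈ Matrix.orthogonalGroup (Fin (2 * l + 1)) ℝ := by
  have h : (harmonicRep l R)ᵀ = harmonicRep l R⁻¹ := by
    ext m n
    rw [Matrix.transpose_apply, harmonicRep_apply, harmonicRep_apply, ← inner_rot_left,
      real_inner_comm]
  rw [Matrix.mem_orthogonalGroup_iff, h, ← map_mul, mul_inv_cancel, map_one]

theorem rot_sum_harmonicFun (l : ℕ) (R : SO3) (v : Fin (2 * l + 1) → ℝ) :
    ∑ m, (harmonicRep l R *ᵥ v) m • harmonicFun l m = rot R (∑ n, v n • harmonicFun l n) := by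
  rw [map_sum]
  have h : ∀ n, rot R (v n • harmonicFun l n) =
      ∑ m, (harmonicRep l R m n * v n) • harmonicFun l m := by
    intro n
    rw [map_smul, ← sum_inner_smul_harmonicFun
      (invariant_harmonic l R _ (harmonicFun_mem l n)), Finset.smul_sum]
    exact Finset.sum_congr rfl fun m _ => by rw [smul_smul, mul_comm, harmonicRep_apply]
  simp only [h, Matrix.mulVec, dotProduct, Finset.sum_smul]
  exact Finset.sum_comm

theorem isIrrepOfOrder_harmonicRep (l : ℕ) : IsIrrepOfOrder l (harmonicRep l) := by
  refine ⟨continuous_matrix fun m n => continuous_inner_rot _ _,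
    isIrreducible_matrixRep fun U hU => ?_⟩
  let φ : (Fin (2 * l + 1) → ℝ) →ₗ[ℝ] SphereFun := Fintype.linearCombination ℝ (harmonicFun l)
  have hφ : ∀ v, φ v = ∑ m, v m • harmonicFun l m := fun v => rfl
  have hcoord : ∀ v n, inner ℝ (harmonicFun l n) (φ v) = v n := by
    intro v n
    simp [hφ, inner_sum, inner_smul_right, inner_harmonicFun]
  have hinj : Function.Injective φ := fun v w h => by
    ext n
    rw [← hcoord v, h, hcoord]
  have hmem : ∀ v, φ v ∈ harmonic l := fun v => by
    rw [hφ]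
    exact Submodule.sum_mem _ fun m _ => Submodule.smul_mem _ _ (harmonicFun_mem l m)
  have hinv : Invariant (U.map φ) := by
    rintro R _ ⟨v, hv, rfl⟩
    exact ⟨_, hU R v hv, rot_sum_harmonicFun l R v⟩
  rcases (simple_harmonic l).eq_bot_or_eq _ (Submodule.map_le_iff_le_comap.2 fun v _ => hmem v)
    hinv with h | h
  · left
    exact Submodule.map_injective_of_injective hinj (by rw [h, Submodule.map_bot])
  · right
    rw [eq_top_iff]
    intro v _
    have : φ v ∈ U.map φ := by
      rw [h]
      exact hmem v
    obtain ⟨w, hw, hwv⟩ := this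
    rwa [← hinj hwv]

end SphereFun

/-! ### Existence of equivariant functions on the sphere -/

/-- From `A * (A - 1)ᵀ = -(A - 1)` and odd size, `det (A - 1)` equals its own negative. -/
theorem Matrix.exists_mulVec_eq_self_of_odd {d : ℕ} {A : Matrix (Fin d) (Fin d) ℝ} (hd : Odd d)
    (hA : A ∈ Matrix.orthogonalGroup (Fin d) ℝ) (hdet : A.det = 1) : ∃ v ≠ 0, A *ᵥ v = v := by
  have h1 : A * Aᵀ = 1 := (Matrix.mem_orthogonalGroup_iff _ _).1 hA
  have h2 : (A - 1).det = 0 := by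
    have h3 : A * (A - 1)ᵀ = -(A - 1) := by
      rw [Matrix.transpose_sub, Matrix.mul_sub, h1, Matrix.transpose_one, Matrix.mul_one, neg_sub]
    have h4 := congrArg Matrix.det h3
    rw [Matrix.det_mul, hdet, one_mul, Matrix.det_transpose, Matrix.det_neg, Fintype.card_fin,
      hd.neg_one_pow] at h4
    linarith
  obtain ⟨v, hv, hv2⟩ := Matrix.exists_mulVec_eq_zero_iff.2 h2
  rw [Matrix.sub_mulVec, Matrix.one_mulVec, sub_eq_zero] at hv2
  exact ⟨v, hv, hv2⟩

/-- An orthogonal representation of odd dimension has a unit vector that is fixed by the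
rotations about the polar axis. -/
theorem exists_unit_rotZ_fixed {d : ℕ} (hd : Odd d) {D : SO3 →* Matrix (Fin d) (Fin d) ℝ}
    (hc : Continuous fun R => D R) (hD : ∀ R, D R ∈ Matrix.orthogonalGroup (Fin d) ℝ) :
    ∃ v : Fin d → ℝ, v ⬝ᵥ v = 1 ∧ ∀ t, D (rotZ t) *ᵥ v = v := by
  -- The rotation by `1` is the square of the rotation by `1 / 2`, and an orthogonal determinant
  -- squares to `1`.
  have hdet : (D (rotZ 1)).det = 1 := by
    have h := congrArg Matrix.det ((Matrix.mem_orthogonalGroup_iff _ _).1 (hD (rotZ (1 / 2))))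
    rw [Matrix.det_mul, Matrix.det_transpose, Matrix.det_one] at h
    have h2 : rotZ 1 = rotZ (1 / 2) * rotZ (1 / 2) := by rw [← rotZ_add, add_halves]
    rw [h2, map_mul, Matrix.det_mul, h]
  obtain ⟨v, hv0, hv⟩ := Matrix.exists_mulVec_eq_self_of_odd hd (hD (rotZ 1)) hdet
  -- A vector fixed by the single rotation of angle `1` is fixed by all: its orbit function has
  -- periods `1` and `2 π`.
  have hfix : ∀ t, D (rotZ t) *ᵥ v = v := by
    intro t
    have h := eq_of_periodic_one_of_periodic_two_pi (f := fun t => D (rotZ t) *ᵥ v)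
      ((hc.comp continuous_rotZ).matrix_mulVec continuous_const)
      (fun t => by rw [rotZ_add, map_mul, ← Matrix.mulVec_mulVec, hv])
      (fun t => by rw [rotZ_add, rotZ_two_pi, mul_one]) t
    simpa [rotZ_zero] using h
  have hpos : 0 < v ⬝ᵥ v := by
    refine lt_of_le_of_ne (Finset.sum_nonneg fun i _ => mul_self_nonneg (v i)) fun h => ?_
    exact hv0 (dotProduct_self_eq_zero.1 h.symm)
  refine ⟨(Real.sqrt (v ⬝ᵥ v))⁻¹ • v, ?_, fun t => by rw [Matrix.mulVec_smul, hfix]⟩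
  rw [smul_dotProduct, dotProduct_smul, smul_eq_mul, smul_eq_mul, ← mul_assoc, ← mul_inv,
    Real.mul_self_sqrt hpos.le, inv_mul_cancel₀ hpos.ne']

theorem exists_isSphericalHarmonic (l : ℕ)
    (D : SO3 →* Matrix (Fin (2 * l + 1)) (Fin (2 * l + 1)) ℝ) (hc : Continuous fun R => D R)
    (hD : ∀ R, D R ∈ Matrix.orthogonalGroup (Fin (2 * l + 1)) ℝ) :
    ∃ Y : S2 → EuclideanSpace ℝ (Fin (2 * l + 1)), IsSphericalHarmonic l D Y := by
  obtain ⟨v, hv, hfix⟩ := exists_unit_rotZ_fixed ⟨l, rfl⟩ hc hD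
  choose s hs using exists_rotateSphere_northPole
  -- Two rotations taking the pole to the same point differ by some `rotZ t`, which fixes `v`. So
  -- the value at a point does not depend on the chosen rotation `s x`.
  have hwd : ∀ R S : SO3, rotateSphere R northPole = rotateSphere S northPole →
      D R *ᵥ v = D S *ᵥ v := by
    intro R S h
    obtain ⟨t, ht⟩ := exists_rotZ_eq (S⁻¹ * R) (by
      rw [rotateSphere_mul, h, rotateSphere_inv_self])
    rw [← mul_inv_cancel_left S R, ht, map_mul, ← Matrix.mulVec_mulVec, hfix]
  refine ⟨fun x => WithLp.toLp 2 (D (s x) *ᵥ v), fun R x m => ?_, fun x => ?_⟩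
  · have h : D (s (rotateSphere R x)) *ᵥ v = D R *ᵥ (D (s x) *ᵥ v) := by
      rw [Matrix.mulVec_mulVec, ← map_mul]
      exact hwd _ _ (by rw [hs, rotateSphere_mul, hs])
    exact congrFun h m
  · have h : (D (s x))ᵀ * D (s x) = 1 := (Matrix.mem_orthogonalGroup_iff' _ _).1 (hD _)
    rw [← sq_eq_sq₀ (norm_nonneg _) zero_le_one, EuclideanSpace.real_norm_sq_eq]
    have h2 : (D (s x) *ᵥ v) ⬝ᵥ (D (s x) *ᵥ v) = 1 := by
      rw [Matrix.dotProduct_mulVec, Matrix.vecMul_mulVec, h, Matrix.vecMul_one, hv]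
    simpa [dotProduct, sq] using h2

/-! ### Spherical harmonics are restrictions of homogeneous polynomials -/

namespace IsSphericalHarmonic

variable {l : ℕ} {D : SO3 →* Matrix (Fin (2 * l + 1)) (Fin (2 * l + 1)) ℝ}
  {Y : S2 → EuclideanSpace ℝ (Fin (2 * l + 1))}

theorem continuous_apply (hY : IsSphericalHarmonic l D Y) (hc : Continuous fun R => D R)
    (m : Fin (2 * l + 1)) : Continuous fun x => Y x m := by
  rw [isQuotientMap_rotateSphere_northPole.continuous_iff]
  have h : (fun x => Y x m) ∘ (fun R => rotateSphere R northPole) =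
      fun R => ∑ n, D R m n * Y northPole n := funext fun R => hY.equivariant R northPole m
  rw [h]
  exact continuous_finsetSum _ fun n _ => (hc.matrix_elem m n).mul continuous_const

/-- A component of a spherical harmonic as a continuous function. -/
noncomputable def component (hY : IsSphericalHarmonic l D Y) (hc : Continuous fun R => D R)
    (m : Fin (2 * l + 1)) : SphereFun :=
  (⟨fun x => Y x m, hY.continuous_apply hc m⟩ : C(S2, ℝ))

theorem component_apply (hY : IsSphericalHarmonic l D Y) (hc : Continuous fun R => D R)
    (m : Fin (2 * l + 1)) (x : S2) : hY.component hc m x = Y x m := rfl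

/-- The linear combinations of the components of a spherical harmonic. -/
noncomputable def combination (hY : IsSphericalHarmonic l D Y) (hc : Continuous fun R => D R) :
    (Fin (2 * l + 1) → ℝ) →ₗ[ℝ] SphereFun := Fintype.linearCombination ℝ (hY.component hc)

theorem combination_apply (hY : IsSphericalHarmonic l D Y) (hc : Continuous fun R => D R)
    (w : Fin (2 * l + 1) → ℝ) (x : S2) : hY.combination hc w x = w ⬝ᵥ (Y x).ofLp := by
  change SphereFun.evalAt x (∑ m, w m • hY.component hc m) = _
  rw [map_sum]
  rfl

/-- Coefficient vectors transform by the dual of `D`, which is why irreducibility of the dual is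
needed; `D` need not be orthogonal here. -/
theorem rot_combination (hY : IsSphericalHarmonic l D Y) (hc : Continuous fun R => D R) (R : SO3)
    (w : Fin (2 * l + 1) → ℝ) :
    SphereFun.rot R (hY.combination hc w) = hY.combination hc (w ᵥ* D R⁻¹) := by
  ext x
  have h : (Y (rotateSphere R⁻¹ x)).ofLp = D R⁻¹ *ᵥ (Y x).ofLp := funext (hY.equivariant R⁻¹ x)
  rw [SphereFun.rot_apply, combination_apply, combination_apply, h, Matrix.dotProduct_mulVec]

theorem range_combination (hY : IsSphericalHarmonic l D Y) (hc : Continuous fun R => D R) :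
    LinearMap.range (hY.combination hc) = Submodule.span ℝ (Set.range (hY.component hc)) :=
  Fintype.range_linearCombination ℝ _

/-- The kernel is stable under the dual action. It is not everything: the combination with
coefficients `Y northPole` takes the value `‖Y northPole‖² = 1` at the pole. -/
theorem injective_combination (hY : IsSphericalHarmonic l D Y) (hD : IsIrrepOfOrder l D) :
    Function.Injective (hY.combination hD.continuous) := by
  rw [← LinearMap.ker_eq_bot]
  refine (eq_bot_or_eq_top_of_isIrreducible_dual hD.irreducible _ fun R w hw => ?_).resolve_right
    fun h => ?_
  · rw [LinearMap.mem_ker] at hw ⊢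
    have := hY.rot_combination hD.continuous R⁻¹ w
    rw [inv_inv, hw, map_zero] at this
    exact this.symm
  · have h1 : (Y northPole).ofLp ∈ LinearMap.ker (hY.combination hD.continuous) := by
      rw [h]
      trivial
    have h2 := congrArg (fun f : SphereFun => f northPole) (LinearMap.mem_ker.1 h1)
    simp only [combination_apply, SphereFun.zero_apply] at h2
    have h3 := hY.norm_eq_one northPole
    have h4 : Y northPole = 0 := congrArg (WithLp.toLp 2) (dotProduct_self_eq_zero.1 h2)
    rw [h4, norm_zero] at h3
    exact zero_ne_one h3

/-- Invariant subspaces of the range pull back to stable subspaces of the irreducible dual, so the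
range is simple, of dimension `2 l + 1` by injectivity. -/
theorem range_combination_eq_harmonic (hY : IsSphericalHarmonic l D Y)
    (hD : IsIrrepOfOrder l D) :
    LinearMap.range (hY.combination hD.continuous) = SphereFun.harmonic l := by
  have hinj := hY.injective_combination hD
  have hrank : Module.finrank ℝ (LinearMap.range (hY.combination hD.continuous)) = 2 * l + 1 := by
    rw [LinearMap.finrank_range_of_inj hinj, Module.finrank_fin_fun]
  refine SphereFun.Simple.eq_harmonic ⟨?_, ?_, fun U hU hinv => ?_⟩ hrank
  · rintro R _ ⟨w, rfl⟩
    exact ⟨_, (hY.rot_combination hD.continuous R w).symm⟩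
  · intro h
    rw [h, finrank_bot] at hrank
    omega
  · have hmap : (U.comap (hY.combination hD.continuous)).map (hY.combination hD.continuous) = U :=
      Submodule.map_comap_eq_of_le hU
    rcases eq_bot_or_eq_top_of_isIrreducible_dual hD.irreducible
      (U.comap (hY.combination hD.continuous)) (fun R w hw => by
        have := hY.rot_combination hD.continuous R⁻¹ w
        rw [inv_inv] at this
        rw [Submodule.mem_comap, ← this]
        exact hinv _ _ hw) with h | h
    · left
      rw [← hmap, h, Submodule.map_bot]
    · right
      rw [← hmap, h, Submodule.map_top]

theorem exists_polynomial (hY : IsSphericalHarmonic l D Y) (hD : IsIrrepOfOrder l D)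
    (m : Fin (2 * l + 1)) :
    ∃ p : MvPolynomial (Fin 3) ℝ, p.IsHomogeneous l ∧
      SphereFun.res p = hY.component hD.continuous m := by
  have h : hY.component hD.continuous m ∈ SphereFun.harmonic l := by
    rw [← hY.range_combination_eq_harmonic hD, range_combination]
    exact Submodule.subset_span ⟨m, rfl⟩
  exact h.1

end IsSphericalHarmonic

/-! ### Decomposition of the homogeneous polynomials -/

/-- Rank–nullity for the sum map from the external direct sum: its range is the supremum, so the
bound leaves no room for a kernel. -/
theorem iSupIndep_of_sum_finrank_le {K V ι : Type*} [Field K] [AddCommGroup V] [Module K V]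
    [Fintype ι] (p : ι → Submodule K V) [∀ i, FiniteDimensional K (p i)]
    (h : ∑ i, Module.finrank K (p i) ≤ Module.finrank K (⨆ i, p i : Submodule K V)) :
    iSupIndep p := by
  classical
  apply iSupIndep_of_dfinsupp_lsum_injective
  let f : DirectSum ι (fun i => p i) →ₗ[K] V := DFinsupp.lsum ℕ fun i => (p i).subtype
  change Function.Injective f
  have hr : LinearMap.range f = ⨆ i, p i := (Submodule.iSup_eq_range_dfinsupp_lsum p).symm
  have h1 := LinearMap.finrank_range_add_finrank_ker f
  rw [hr, Module.finrank_directSum] at h1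
  rw [← LinearMap.ker_eq_bot, ← Submodule.finrank_eq_zero (R := K)]
  omega

namespace SphereFun

theorem sphPoly_le_iSup_harmonic (l : ℕ) :
    sphPoly l ≤ ⨆ k : Fin (l / 2 + 1), harmonic (l - 2 * k) := by
  have h0 : ∀ l, harmonic l ≤ ⨆ k : Fin (l / 2 + 1), harmonic (l - 2 * k) := fun l =>
    le_iSup (fun k : Fin (l / 2 + 1) => harmonic (l - 2 * k)) 0
  induction l using Nat.twoStepInduction with
  | zero =>
    rw [← lowerSphPoly_sup_harmonic]
    exact sup_le bot_le (h0 0)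
  | one =>
    rw [← lowerSphPoly_sup_harmonic]
    exact sup_le bot_le (h0 1)
  | more l ih _ =>
    rw [← lowerSphPoly_sup_harmonic]
    refine sup_le (ih.trans (iSup_le fun k => ?_)) (h0 _)
    have hk : (k : ℕ) + 1 < (l + 2) / 2 + 1 := by omega
    have := le_iSup (fun k : Fin ((l + 2) / 2 + 1) => harmonic (l + 2 - 2 * k)) ⟨k + 1, hk⟩
    rwa [show l + 2 - 2 * ((⟨k + 1, hk⟩ : Fin ((l + 2) / 2 + 1)) : ℕ) = l - 2 * k by
      simp only; omega] at this

theorem map_res_normPowMulSpan {ι : Type} (k : ℕ) (P : ι → MvPolynomial (Fin 3) ℝ) :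
    (normPowMulSpan k P).map res = Submodule.span ℝ (Set.range fun i => res (P i)) := by
  have h : res ∘ₗ LinearMap.mulLeft ℝ (normSqPoly ^ k) = res :=
    LinearMap.ext fun p => res_normSqPoly_pow_mul k p
  rw [normPowMulSpan, ← Submodule.map_comp, h, Submodule.map_span, ← Set.range_comp]
  rfl

theorem normPowMulSpan_le {ι : Type} {k j l : ℕ} (h : 2 * k + j = l)
    {P : ι → MvPolynomial (Fin 3) ℝ} (hP : ∀ i, (P i).IsHomogeneous j) :
    normPowMulSpan k P ≤ MvPolynomial.homogeneousSubmodule (Fin 3) ℝ l := by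
  rw [normPowMulSpan, Submodule.map_span, Submodule.span_le]
  rintro _ ⟨_, ⟨i, rfl⟩, rfl⟩
  rw [← h]
  exact (isHomogeneous_normSqPoly.pow k).mul (hP i)

theorem finrank_map_res {l : ℕ} {M : Submodule ℝ (MvPolynomial (Fin 3) ℝ)}
    (hM : M ≤ MvPolynomial.homogeneousSubmodule (Fin 3) ℝ l) :
    Module.finrank ℝ (M.map res) = Module.finrank ℝ M :=
  (LinearEquiv.finrank_eq (LinearEquiv.ofBijective (res.submoduleMap M)
    ⟨fun _ _ h => Subtype.ext ((injOn_res l).mono hM (Subtype.coe_prop _) (Subtype.coe_prop _)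
      (congrArg Subtype.val h)), LinearMap.submoduleMap_surjective _ _⟩)).symm

/-- The `k`-th space restricts to `harmonic (l - 2 * k)`, and restriction is injective in degree
`l`. This gives the dimensions and the supremum; independence follows because the dimensions add up.
-/
theorem iSupIndep_and_iSup_eq_and_finrank_normPowMulSpan
    {P : ∀ l : ℕ, Fin (2 * l + 1) → MvPolynomial (Fin 3) ℝ}
    (hP : ∀ l m, (P l m).IsHomogeneous l)
    (hspan : ∀ l, Submodule.span ℝ (Set.range fun m => res (P l m)) = harmonic l) (l : ℕ) :
    iSupIndep (fun k : Fin (l / 2 + 1) => normPowMulSpan k (P (l - 2 * k))) ∧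
    (⨆ k : Fin (l / 2 + 1), normPowMulSpan k (P (l - 2 * k))) =
      MvPolynomial.homogeneousSubmodule (Fin 3) ℝ l ∧
    ∀ k : Fin (l / 2 + 1),
      Module.finrank ℝ (normPowMulSpan k (P (l - 2 * k))) = 2 * (l - 2 * k) + 1 := by
  have : FiniteDimensional ℝ (MvPolynomial.homogeneousSubmodule (Fin 3) ℝ l) :=
    finiteDimensional_homogeneousSubmodule l
  have hle : ∀ k : Fin (l / 2 + 1), normPowMulSpan k (P (l - 2 * k)) ≤
      MvPolynomial.homogeneousSubmodule (Fin 3) ℝ l := fun k =>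
    normPowMulSpan_le (by omega) (hP _)
  have hrank : ∀ k : Fin (l / 2 + 1),
      Module.finrank ℝ (normPowMulSpan k (P (l - 2 * k))) = 2 * (l - 2 * k) + 1 := fun k => by
    rw [← finrank_map_res (hle k), map_res_normPowMulSpan, hspan, finrank_harmonic]
  have hsup : (⨆ k : Fin (l / 2 + 1), normPowMulSpan k (P (l - 2 * k))) =
      MvPolynomial.homogeneousSubmodule (Fin 3) ℝ l := by
    apply le_antisymm (iSup_le hle)
    intro p hp
    have h1 := sphPoly_le_iSup_harmonic l (res_mem_sphPoly hp)
    have h2 : ∀ k : Fin (l / 2 + 1), harmonic (l - 2 * k) =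
        (normPowMulSpan k (P (l - 2 * k))).map res := fun k => by
      rw [map_res_normPowMulSpan, hspan]
    rw [iSup_congr h2, ← Submodule.map_iSup] at h1
    obtain ⟨q, hq, hqp⟩ := h1
    rwa [← injOn_res l (iSup_le hle hq) hp hqp]
  refine ⟨?_, hsup, hrank⟩
  have (k : Fin (l / 2 + 1)) : FiniteDimensional ℝ (normPowMulSpan k (P (l - 2 * k))) :=
    Submodule.finiteDimensional_of_le (hle k)
  apply iSupIndep_of_sum_finrank_le
  rw [hsup, finrank_homogeneousSubmodule_fin_three, sum_range_half_two_mul_sub_add_one,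
    Finset.sum_range]
  exact (Finset.sum_congr rfl fun k _ => hrank k).le

end SphereFun

/-- Both sides are homogeneous of degree `l` in `x`, so equality on the sphere suffices. -/
theorem eval_rotate_of_eval_rotateSphere {l : ℕ} {ι : Type*} [Fintype ι]
    {P : ι → MvPolynomial (Fin 3) ℝ} (hP : ∀ m, (P m).IsHomogeneous l) (R : SO3) {a : ι → ℝ} {m : ι}
    (h : ∀ x : S2, MvPolynomial.eval (rotateSphere R x : E3).ofLp (P m) =
      ∑ n, a n * MvPolynomial.eval (x : E3).ofLp (P n)) (x : E3) :
    MvPolynomial.eval (rotate R x).ofLp (P m) = ∑ n, a n * MvPolynomial.eval x.ofLp (P n) := by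
  obtain ⟨u, hu⟩ := exists_eq_norm_smul x
  have h1 : x.ofLp = ‖x‖ • (u : E3).ofLp := congrArg WithLp.ofLp hu
  have h2 : (rotate R x).ofLp = ‖x‖ • (rotateSphere R u : E3).ofLp := by
    conv_lhs => rw [hu, rotate_smul]
    rfl
  rw [h2, (hP m).eval_smul, h, Finset.mul_sum]
  refine Finset.sum_congr rfl fun n _ => ?_
  rw [h1, (hP n).eval_smul]
  ring

theorem mainTheorem3 :
    -- for every order there are orthogonal irreducible representations,
    (∀ l : ℕ, ∃ D : SO3 →* Matrix (Fin (2 * l + 1)) (Fin (2 * l + 1)) ℝ,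
      IsIrrepOfOrder l D ∧ ∀ R, D R ∈ Matrix.orthogonalGroup (Fin (2 * l + 1)) ℝ) ∧
    -- and for each of them there are spherical harmonics;
    (∀ (l : ℕ) (D : SO3 →* Matrix (Fin (2 * l + 1)) (Fin (2 * l + 1)) ℝ),
      IsIrrepOfOrder l D → (∀ R, D R ∈ Matrix.orthogonalGroup (Fin (2 * l + 1)) ℝ) →
      ∃ Y : S2 → EuclideanSpace ℝ (Fin (2 * l + 1)), IsSphericalHarmonic l D Y) ∧
    -- whatever the choice of the representations and of the spherical harmonics,
    (∀ (D : ∀ l : ℕ, SO3 →* Matrix (Fin (2 * l + 1)) (Fin (2 * l + 1)) ℝ)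
      (Y : ∀ l : ℕ, S2 → EuclideanSpace ℝ (Fin (2 * l + 1))),
      (∀ l, IsIrrepOfOrder l (D l)) → (∀ l, IsSphericalHarmonic l (D l) (Y l)) →
      ∃ P : ∀ l : ℕ, Fin (2 * l + 1) → MvPolynomial (Fin 3) ℝ,
        -- the spherical harmonics extend to homogeneous polynomials of degree `l`,
        (∀ l m, (P l m).IsHomogeneous l) ∧
        (∀ l m (x : S2), MvPolynomial.eval (x : E3).ofLp (P l m) = Y l x m) ∧
        -- the extensions are equivariant on the whole space,
        (∀ l m (R : SO3) (x : E3), MvPolynomial.eval (rotate R x).ofLp (P l m) =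
          ∑ n, D l R m n * MvPolynomial.eval x.ofLp (P l n)) ∧
        -- and the homogeneous polynomials of degree `l` are the direct sum of the spaces
        -- `‖x‖^{2k} Y^{l-2k}`, `0 ≤ 2k ≤ l`, which have dimension `2 (l - 2k) + 1`.
        ∀ l : ℕ,
          iSupIndep (fun k : Fin (l / 2 + 1) => normPowMulSpan k (P (l - 2 * k))) ∧
          (⨆ k : Fin (l / 2 + 1), normPowMulSpan k (P (l - 2 * k))) =
            MvPolynomial.homogeneousSubmodule (Fin 3) ℝ l ∧
          ∀ k : Fin (l / 2 + 1),
            Module.finrank ℝ (normPowMulSpan k (P (l - 2 * k))) = 2 * (l - 2 * k) + 1) ∧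
    -- the dimension count
    (∀ l : ℕ,
      Module.finrank ℝ (MvPolynomial.homogeneousSubmodule (Fin 3) ℝ l) = (l + 2) * (l + 1) / 2 ∧
      (l + 2) * (l + 1) / 2 = ∑ k ∈ Finset.range (l / 2 + 1), (2 * (l - 2 * k) + 1)) := by
  refine ⟨fun l => ⟨SphereFun.harmonicRep l, SphereFun.isIrrepOfOrder_harmonicRep l,
      SphereFun.harmonicRep_mem_orthogonalGroup l⟩,
    fun l D hD ho => exists_isSphericalHarmonic l D hD.continuous ho, fun D Y hD hY => ?_,
    fun l => ⟨finrank_homogeneousSubmodule_fin_three l, sum_range_half_two_mul_sub_add_one l⟩⟩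
  choose P hP hres using fun l => (hY l).exists_polynomial (hD l)
  have heval : ∀ l m (x : S2), MvPolynomial.eval (x : E3).ofLp (P l m) = Y l x m := fun l m x => by
    rw [← SphereFun.res_apply, hres, IsSphericalHarmonic.component_apply]
  refine ⟨P, hP, heval, fun l m R x => ?_,
    SphereFun.iSupIndep_and_iSup_eq_and_finrank_normPowMulSpan hP fun l => ?_⟩
  · refine eval_rotate_of_eval_rotateSphere (hP l) R (fun u => ?_) x
    simp only [heval]
    exact (hY l).equivariant R u m
  · simp only [hres]
    rw [← (hY l).range_combination_eq_harmonic (hD l), IsSphericalHarmonic.range_combination]
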